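/- Let $\vec{\mathbb L}^2$ be the square lattice $\mathbb Z^2$ with both directed edges $x\to y$, $y\to x$ between nearest neighbours; for an edge $\vec e=x\to y$ write $\vec e(1)=x$, $\vec e(2)=y$. Subgraphs of $\vec{\mathbb L}^2$ are identified with elements of $E=\{0,1\}^{\vec{\mathbb L}^2}$ (coordinates: vertices and edges), with the metric $\rho(\eta,\zeta)=\sum_x\alpha(x)|\eta(x)-\zeta(x)|$ for strictly positive summable weights $\alpha$. Let $D_E[0,\infty)$ be the space of right-continuous functions $[0,\infty)\to E$ with left limits, with the Skorokhod topology induced by $\rho$. Let $\mathbb H=\{x\in\mathbb Z^2: x(2)\ge 0\}$, let $\vec{\mathbb H}$ be the subgraph consisting of $\mathbb H$ and all edges with both endpoints in $\mathbb H$, and put $\ell_k=\{x: x(2)=k\}$, $D_n=\{-n,\dots,n\}\times\{0\}$. Let $\partial^eA$ be the set of edges $\vec e$ with $\vec e(1)\notin A$, $\vec e(2)\in A$. Let $S$ be simple random walk on $\mathbb Z^2$, started from $z$ under $\mathbf P_z$, and $\tau_A=\inf\{k\ge1:S_k\in A\}$. For finite nonempty $A$ the edge harmonic measure is $$\mathcal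 H^e_A(\vec e)=\lim_{\|z\|\to\infty}\mathbf P_z\big(S_{\tau_A}=\vec e(2),\ S_{\tau_A-1}=\vec e(1)\big),$$ and for $B\subseteq\mathbb H$, $\vec e\in\partial^e B$, the stationary harmonic measure is $$\mathcal H^s_B(\vec e)=\lim_{N\to\infty}\sum_{z\in\ell_N\setminus B}\mathbf P_z\big(S_{\tau_{B\cup\ell_0}}=\vec e(2),\ S_{\tau_{B\cup\ell_0}-1}=\vec e(1)\big).$$ Let $EA^n_t$ be the edge DLA process with $EA^n_0=(D_n,\emptyset)$: it has paths in $D_E[0,\infty)$, at most one edge is added at any time, and when the vertex set is $V$ each edge $\vec e\in\partial^eV$ is added, together with the vertex $\vec e(1)$, at rate $\mathcal H^e_V(\vec e)$. Let $SA^\infty_t$ be an infinite stationary DLA process: it starts from $(\ell_0,\emptyset)$ and grows in the same way with rates $\mathcal H^s_V(\vec e)$. (The rates are understood as the stochastic intensities, in the natural filtration of the process, with which the edges appear.) Let $c\in(0,\infty)$. Then the following are equivalent: 1. $\{EA^n_{nt}\cap\vec{\mathbb H}\}_{t\ge0}$ converges weakly to $\{SA^\infty_{ct}\}_{t\ge0}$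 on $D_E[0,\infty)$ with the Skorokhod topology as $n\to\infty$. 2. For all $k$ and $t_1,\dots,t_k\ge 0$, $(EA^n_{nt_1}\cap\vec{\mathbb H},\dots,EA^n_{nt_k}\cap\vec{\mathbb H})$ converges in distribution to $(SA^\infty_{ct_1},\dots,SA^\infty_{ct_k})$ in $E^k$ as $n\to\infty$. 3. For every $\epsilon>0$, every finite subgraph $K\subseteq\vec{\mathbb H}$ and every $T<\infty$ there is $N_0<\infty$ such that for every integer $n\ge1$, all $0<t_1,\dots,t_n\le T$ and all subgraphs $K_1,\dots,K_n\subseteq K$, $$\Big|\mathbf P\big(SA^\infty_{ct_1}\cap K=K_1,\dots,SA^\infty_{ct_n}\cap K=K_n\big)-\mathbf P\big(EA^N_{Nt_1}\cap K=K_1,\dots,EA^N_{Nt_n}\cap K=K_n\big)\Big|<\epsilon$$ for all $N\ge N_0$. -/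

import Mathlib

open MeasureTheory Filter Topology
open scoped NNReal ENNReal

noncomputable section

namespace DLA

/-! ### The directed square lattice and its subgraphs -/

/-- Vertices of the square lattice. -/
abbrev Vtx := ℤ × ℤ

/-- Nearest neighbours: Euclidean distance one. -/
def Adj (x y : Vtx) : Prop := (x.1 - y.1) ^ 2 + (x.2 - y.2) ^ 2 = 1

/-- Directed edges `x → y` between nearest neighbours. -/
abbrev Edge := {e : Vtx × Vtx // Adj e.1 e.2}

/-- The starting point of a directed edge. -/
def Edge.source (e : Edge) : Vtx := e.1.1

/-- The ending point of a directed edge. -/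
def Edge.target (e : Edge) : Vtx := e.1.2

/-- The sites of the directed lattice: its vertices and its directed edges. -/
abbrev Site := Vtx ⊕ Edge

/-- Configurations in `{0,1}` indexed by vertices and edges, with the product topology and the
product `σ`-algebra. A graph `(V, E)` is identified with the indicator of its vertices and edges,
so that the intersection of graphs is `⊓` and inclusion of graphs is `≤`. -/
abbrev Config := Site → Bool

/-- The vertex set of a configuration. -/
def Config.verts (η : Config) : Set Vtx := {x | η (Sum.inl x) = true}

/-- The edge set of a configuration. -/
def Config.edges (η : Config) : Set Edge := {e | η (Sum.inr e) = true}

/-- A configuration is a subgraph of the lattice if it contains both endpoints of its edges. -/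
def Config.IsSubgraph (η : Config) : Prop :=
  ∀ e ∈ η.edges, e.source ∈ η.verts ∧ e.target ∈ η.verts

open Classical in
/-- The configuration with given vertex set and edge set. -/
def mkConfig (V : Set Vtx) (E : Set Edge) : Config :=
  Sum.elim (fun x => decide (x ∈ V)) (fun e => decide (e ∈ E))

/-- The subgraph whose edges are all edges with both endpoints in `A`. -/
def inducedGraph (A : Set Vtx) : Config :=
  mkConfig A {e | e.source ∈ A ∧ e.target ∈ A}

/-- The upper half plane, including the horizontal axis. -/
def upperHalf : Set Vtx := {x | 0 ≤ x.2}

/-- The graph of the upper half plane. -/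
def halfGraph : Config := inducedGraph upperHalf

/-- The horizontal line at height `n`. -/
def line (n : ℕ) : Set Vtx := {x | x.2 = n}

/-- The segment `[-n, n] × {0}`. -/
def segment (n : ℕ) : Set Vtx := {x | -(n : ℤ) ≤ x.1 ∧ x.1 ≤ n ∧ x.2 = 0}

/-- Inner vertex boundary. -/
def innerBoundary (A : Set Vtx) : Set Vtx := {x | x ∈ A ∧ ∃ y, y ∉ A ∧ Adj x y}

/-- Outer vertex boundary. -/
def outerBoundary (A : Set Vtx) : Set Vtx := {x | x ∉ A ∧ ∃ y, y ∈ A ∧ Adj x y}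

/-- Edge boundary: the edges pointing from the outer boundary to the inner boundary. -/
def edgeBoundary (A : Set Vtx) : Set Edge :=
  {e | e.source ∈ outerBoundary A ∧ e.target ∈ innerBoundary A}

/-! ### Simple random walk and the two harmonic measures -/

/-- The uniform law on the four unit steps. -/
def stepLaw : PMF Vtx :=
  PMF.uniformOfFinset {((1 : ℤ), (0 : ℤ)), (-1, 0), (0, 1), (0, -1)} (by simp)

/-- The law of an independent sequence of uniform steps. -/
def walkLaw : Measure (ℕ → Vtx) := Measure.infinitePi (fun _ : ℕ => stepLaw.toMeasure)

/-- The simple random walk started at `z` and driven by the steps `ξ`. -/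
def walk (z : Vtx) (ξ : ℕ → Vtx) (n : ℕ) : Vtx := z + ∑ i ∈ Finset.range n, ξ i

/-- `k` is the first time `≥ 1` at which the trajectory `S` is in `A`. -/
def IsReturnTime (S : ℕ → Vtx) (A : Set Vtx) (k : ℕ) : Prop :=
  1 ≤ k ∧ S k ∈ A ∧ ∀ j, 1 ≤ j → j < k → S j ∉ A

/-- The probability that the walk from `z` first returns to `A`, at a finite time `τ`, through the
edge `e`: `S τ = e.target` and `S (τ - 1) = e.source`. -/
def hitProb (A : Set Vtx) (e : Edge) (z : Vtx) : ℝ≥0∞ :=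
  walkLaw {ξ | ∃ k, IsReturnTime (walk z ξ) A k ∧
    walk z ξ k = e.target ∧ walk z ξ (k - 1) = e.source}

/-- The edge harmonic measure of `e` with respect to `A` (the limit `‖z‖ → ∞` is the limit along
the cofinite filter of the lattice). -/
def edgeHarmonic (A : Set Vtx) (e : Edge) : ℝ≥0∞ :=
  limUnder (cofinite : Filter Vtx) (hitProb A e)

/-- The approximation at height `N` of the stationary harmonic measure. -/
def statHarmonicAt (B : Set Vtx) (N : ℕ) (e : Edge) : ℝ≥0∞ :=
  ∑' z : {z : Vtx // z ∈ line N \ B}, hitProb (B ∪ line 0) e z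

/-- The stationary harmonic measure of `e` with respect to `B`. -/
def statHarmonic (B : Set Vtx) (e : Edge) : ℝ≥0∞ :=
  limUnder atTop (fun N : ℕ => statHarmonicAt B N e)

/-! ### Path space and the Skorokhod topology -/

/-- Strictly positive summable weights on the sites. -/
structure Weight where
  toFun : Site → ℝ
  pos : ∀ x, 0 < toFun x
  summable : Summable toFun

/-- The metric `ρ(η, ζ) = ∑ α(x) |η(x) - ζ(x)|` on configurations. -/
def rho (w : Weight) (η ζ : Config) : ℝ := ∑' x, if η x = ζ x then 0 else w.toFun x

/-- Right continuous functions with left limits from `[0, ∞)` to configurations. The weight `w`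
only serves to choose the metric on configurations from which the Skorokhod metric is built. -/
structure Path (w : Weight) where
  toFun : ℝ≥0 → Config
  right_cont : ∀ t, ContinuousWithinAt toFun (Set.Ici t) t
  left_lim : ∀ t, ∃ η, Tendsto toFun (𝓝[<] t) (𝓝 η)

instance (w : Weight) : CoeFun (Path w) (fun _ => ℝ≥0 → Config) := ⟨Path.toFun⟩

/-- The size `γ(φ) = sup_{s > t} |log ((φ s - φ t) / (s - t))|` of a time change `φ`. -/
def timeChangeSize (φ : ℝ≥0 ≃o ℝ≥0) : ℝ≥0∞ :=
  ⨆ (t : ℝ≥0) (s : ℝ≥0) (_ : t < s),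
    ENNReal.ofReal |Real.log (((φ s : ℝ) - φ t) / ((s : ℝ) - t))|

/-- The distance `sup_t (ρ(x(t ∧ u), y(φ(t) ∧ u)) ∧ 1)`. -/
def stoppedDist {w : Weight} (x y : Path w) (φ : ℝ≥0 ≃o ℝ≥0) (u : ℝ≥0) : ℝ≥0∞ :=
  ⨆ t : ℝ≥0, ENNReal.ofReal (min (rho w (x (min t u)) (y (min (φ t) u))) 1)

/-- The Skorokhod metric on paths,
`d(x, y) = inf_φ max (γ(φ), ∫_0^∞ e^{-u} sup_t (ρ(x(t ∧ u), y(φ(t) ∧ u)) ∧ 1) du)`,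
the infimum being over all increasing bijections `φ` of `[0, ∞)` (those with `γ(φ) = ∞` do not
contribute). -/
def skorokhodDist {w : Weight} (x y : Path w) : ℝ≥0∞ :=
  ⨅ φ : ℝ≥0 ≃o ℝ≥0, max (timeChangeSize φ)
    (∫⁻ u in Set.Ioi (0 : ℝ), ENNReal.ofReal (Real.exp (-u)) * stoppedDist x y φ u.toNNReal)

/-- The Skorokhod topology: the topology of the metric `skorokhodDist`. -/
instance (w : Weight) : TopologicalSpace (Path w) where
  IsOpen U := ∀ x ∈ U, ∃ ε : ℝ≥0∞, 0 < ε ∧ ∀ y, skorokhodDist x y < ε → y ∈ U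
  isOpen_univ := fun _ _ => ⟨1, one_pos, fun _ _ => trivial⟩
  isOpen_inter := by
    rintro U V hU hV x ⟨hxU, hxV⟩
    obtain ⟨a, ha, hUa⟩ := hU x hxU
    obtain ⟨b, hb, hVb⟩ := hV x hxV
    exact ⟨min a b, lt_min ha hb, fun y hy =>
      ⟨hUa y (hy.trans_le (min_le_left _ _)), hVb y (hy.trans_le (min_le_right _ _))⟩⟩
  isOpen_sUnion := by
    rintro S hS x ⟨U, hU, hxU⟩
    obtain ⟨a, ha, hUa⟩ := hS U hU x hxU
    exact ⟨a, ha, fun y hy => ⟨U, hU, hUa y hy⟩⟩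

/-- The Borel `σ`-algebra of the Skorokhod topology. -/
instance (w : Weight) : MeasurableSpace (Path w) := borel _

instance (w : Weight) : BorelSpace (Path w) := ⟨rfl⟩

/-- The path `t ↦ x (a t)`. -/
def Path.speed {w : Weight} (x : Path w) (a : ℝ≥0) : Path w where
  toFun t := x (a * t)
  right_cont t := by
    refine (x.right_cont (a * t)).comp (by fun_prop) ?_
    intro s hs
    exact mul_le_mul_right (Set.mem_Ici.1 hs) a
  left_lim t := by
    rcases eq_or_ne a 0 with rfl | ha
    · exact ⟨x 0, by simpa using tendsto_const_nhds⟩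
    · obtain ⟨η, hη⟩ := x.left_lim (a * t)
      refine ⟨η, hη.comp ?_⟩
      refine tendsto_nhdsWithin_iff.2 ⟨?_, ?_⟩
      · exact tendsto_nhdsWithin_of_tendsto_nhds ((continuous_const_mul a).tendsto t)
      · filter_upwards [self_mem_nhdsWithin] with s hs
        exact mul_lt_mul_of_pos_left hs (pos_iff_ne_zero.2 ha)

/-- The path `t ↦ x t ∩ G`. -/
def Path.inter {w : Weight} (x : Path w) (G : Config) : Path w where
  toFun t := x t ⊓ G
  right_cont t := by
    have h : Continuous fun η : Config => η ⊓ G :=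
      continuous_pi fun i => (continuous_of_discreteTopology (f := fun b : Bool => b ⊓ G i)).comp
        (continuous_apply i)
    exact h.continuousAt.comp_continuousWithinAt (x.right_cont t)
  left_lim t := by
    have h : Continuous fun η : Config => η ⊓ G :=
      continuous_pi fun i => (continuous_of_discreteTopology (f := fun b : Bool => b ⊓ G i)).comp
        (continuous_apply i)
    obtain ⟨η, hη⟩ := x.left_lim t
    exact ⟨η ⊓ G, (h.tendsto η).comp hη⟩

/-! ### Growth processes -/

/-- The `σ`-algebra of the past `(X u)_{u ≤ s}`. -/
abbrev past {w : Weight} {Ω : Type*} (X : Ω → Path w) (s : ℝ≥0) : MeasurableSpace Ω :=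
  ⨆ u : Set.Iic s, MeasurableSpace.comap (fun ω => X ω u) inferInstance

open Classical in
/-- The process `X`, defined on the probability space `(Ω, P)`, starts from the graph `(V₀, ∅)`
and adds each edge `e` of the edge boundary of its current vertex set `V`, together with the
vertex `e.source`, at the rate `rate V e`, the clocks of different edges being independent given
the current state. In terms of stochastic intensities: at most one edge is added at any time, and
`rate V e` (for `e` in the edge boundary of `V`) is the intensity with which `e` appears, that is,
the indicator of `e` being present minus the time integral of this rate is a martingale. -/
structure IsEdgeGrowth {w : Weight} {Ω : Type*} [MeasurableSpace Ω] (P : Measure Ω)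
    (rate : Set Vtx → Edge → ℝ≥0∞) (V₀ : Set Vtx) (X : Ω → Path w) : Prop where
  /-- `X` is a random element of the path space. -/
  measurable : Measurable X
  /-- `X` is a stochastic process. -/
  measurable_eval : ∀ t, Measurable fun ω => X ω t
  /-- The initial state. -/
  initial : ∀ᵐ ω ∂P, X ω 0 = mkConfig V₀ ∅
  /-- At any time, with `η` the state just before it, either nothing happens or exactly one
  edge of the edge boundary is added, together with its starting point. -/
  jump : ∀ᵐ ω ∂P, ∀ t, 0 < t → ∀ η : Config, Tendsto (X ω) (𝓝[<] t) (𝓝 η) →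
    X ω t = η ∨ ∃ e ∈ edgeBoundary η.verts,
      X ω t = mkConfig (insert e.source η.verts) (insert e η.edges)
  /-- The probability that `e` is added during `(s, t]`, on an event `A` of the past of `s`, is
  the expectation on `A` of the rate integrated over `(s, t]`. -/
  intensity : ∀ (e : Edge) (s t : ℝ≥0), s ≤ t → ∀ A : Set Ω, MeasurableSet[past X s] A →
    P (A ∩ {ω | e ∈ (X ω t).edges ∧ e ∉ (X ω s).edges}) =
      ∫⁻ ω in A, (∫⁻ u in Set.Ioc (s : ℝ) t,
        (if e ∈ edgeBoundary (X ω u.toNNReal).verts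
          then rate (X ω u.toNNReal).verts e else 0)) ∂P

/-- Edge diffusion limited aggregation started from the vertex set `B`. -/
def IsEDLA {w : Weight} {Ω : Type*} [MeasurableSpace Ω] (P : Measure Ω) (B : Set Vtx)
    (X : Ω → Path w) : Prop :=
  IsEdgeGrowth P edgeHarmonic B X

/-- The infinite stationary diffusion limited aggregation, started from the horizontal axis. -/
def IsInfiniteSDLA {w : Weight} {Ω : Type*} [MeasurableSpace Ω] (P : Measure Ω)
    (X : Ω → Path w) : Prop :=
  IsEdgeGrowth P statHarmonic (line 0) X

end DLA

end

/-!
All processes here are monotone with values in `{0,1}`-configurations, so a path is described by the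
times `hit x i` at which the sites `i` appear. The three modes of convergence are compared through
these times. The processes enter only through the properties collected in `IsGrowthApproximation`:

* A growing graph is determined by its edges: its vertices are the initial ones and the starting
  points of its edges (`IsGrowthPath.vert_iff`, `IsRooted`). Different edges appear at different
  times (`IsGrowthPath.hit_edge_injOn`).
* The limit does not add an edge at a fixed time. The probability that an edge appears in a time
  interval is the expected integral of its rate over the interval, hence finite, and it vanishes as
  the interval shrinks (`IsEdgeGrowth.continuous_prob_edge`).
* The limit stays in the upper half plane, because a random walk coming from above hits the axis
  before it can use an edge that starts below it (`IsInfiniteSDLA.ae_le_halfGraph`).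

Weak convergence implies convergence of the finite dimensional distributions because hitting times
are continuous functionals for the Skorokhod topology (`continuous_hit`), and they determine the
state at time `t` in a locally constant way off the null event that some hitting time equals `t`
(`exists_isOpen_hit`).

Conversely, if finitely many edges of a path with pairwise different jump times are observed at
suitable finitely many times, then any other monotone path with the same observations adds these
edges at nearly the same times. A time change of the form `t ↦ t + ψ t`, with `ψ` a function of
small Lipschitz constant that extends prescribed values on a finite set, matches the jumps, so the
paths are close in the Skorokhod metric (`exists_skorokhodDist_lt_of_agree`). Hence an open set of
paths is, up to a null set, exhausted by events that depend on finitely many observations. No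
separate tightness argument is needed. Both implications use the portmanteau criterion for open
sets.

For uniform convergence of the probabilities of cylinder events, arbitrarily many observations of a
monotone path on a finite set of sites reduce to at most two constraints per site
(`exists_constraints`). Their times may be rounded to a fixed grid with a small error, as the
marginals of the limit are continuous, and only finitely many events remain. In the opposite
direction, open sets of configurations are exhausted by finite disjoint unions of cylinder events,
and the observations at time zero are deterministic (`tendsto_cylinder`).
-/

namespace DLA

variable {w : Weight}

/-! ### Paths of growth processes -/

lemma eventually_coord_eq {α : Type*} {l : Filter α} {f : α → Config} {η : Config}
    (h : Tendsto f l (𝓝 η)) (i : Site) : ∀ᶠ s in l, f s i = η i :=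
  (((continuous_apply i).tendsto η).comp h).eventually (p := fun b => b = η i)
    (by simp [nhds_discrete])

lemma Path.eventually_eq_right (x : Path w) (i : Site) (t : ℝ≥0) :
    ∀ᶠ s in 𝓝[≥] t, x s i = x t i :=
  eventually_coord_eq (x.right_cont t) i

/-- A coordinate of a path which takes the value `b` at `t` but not at `s < t` jumps to `b` at some
time in `(s, t]`. -/
lemma Path.exists_jump (x : Path w) {i : Site} {b : Bool} {s t : ℝ≥0} (hst : s ≤ t)
    (hs : x s i ≠ b) (ht : x t i = b) :
    ∃ u, s < u ∧ u ≤ t ∧ x u i = b ∧ ∃ η : Config, Tendsto x (𝓝[<] u) (𝓝 η) ∧ η i ≠ b := by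
  set A : Set ℝ≥0 := {r | s ≤ r ∧ x r i = b} with hA
  have htA : t ∈ A := ⟨hst, ht⟩
  have hbdd : BddBelow A := ⟨0, fun _ _ => zero_le⟩
  set u := sInf A with hu
  have hsu : s ≤ u := le_csInf ⟨t, htA⟩ fun r hr => hr.1
  have hut : u ≤ t := csInf_le hbdd htA
  have hub : x u i = b := by
    by_contra hne
    obtain ⟨v, hv, hvs⟩ := (mem_nhdsGE_iff_exists_Ico_subset' (lt_add_one u)).1
      (x.eventually_eq_right i u)
    obtain ⟨r, hr, hrv⟩ := (csInf_lt_iff hbdd ⟨t, htA⟩).1 (show sInf A < v from hv)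
    have := hvs ⟨csInf_le hbdd hr, hrv⟩
    simp only [Set.mem_ofPred_eq] at this
    exact hne (this.symm.trans hr.2)
  have hsu' : s < u := lt_of_le_of_ne hsu fun h => hs (h ▸ hub)
  obtain ⟨η, hη⟩ := x.left_lim u
  refine ⟨u, hsu', hut, hub, η, hη, fun hηb => ?_⟩
  have : (𝓝[<] u).NeBot := nhdsLT_neBot_of_exists_lt ⟨s, hsu'⟩
  obtain ⟨r, hr1, hr2⟩ := ((eventually_coord_eq hη i).and
    (Ioo_mem_nhdsLT hsu')).exists
  exact absurd (csInf_le hbdd ⟨hr2.1.le, hr1.trans hηb⟩) (not_le.2 hr2.2)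

/-- A path that starts from the graph `(V₀, ∅)` and grows by adding single edges of the edge
boundary of its vertex set, together with their starting points. -/
structure IsGrowthPath (V₀ : Set Vtx) (x : Path w) : Prop where
  initial : x 0 = mkConfig V₀ ∅
  jump : ∀ t, 0 < t → ∀ η : Config, Tendsto x (𝓝[<] t) (𝓝 η) →
    x t = η ∨ ∃ e ∈ edgeBoundary η.verts,
      x t = mkConfig (insert e.source η.verts) (insert e η.edges)

lemma IsEdgeGrowth.ae_isGrowthPath {Ω : Type*} [MeasurableSpace Ω] {P : Measure Ω}
    {rate : Set Vtx → Edge → ℝ≥0∞} {V₀ : Set Vtx} {X : Ω → Path w}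
    (h : IsEdgeGrowth P rate V₀ X) : ∀ᵐ ω ∂P, IsGrowthPath V₀ (X ω) := by
  filter_upwards [h.initial, h.jump] with ω h1 h2 using ⟨h1, h2⟩

@[simp] lemma mkConfig_inl (V : Set Vtx) (E : Set Edge) (v : Vtx) :
    mkConfig V E (Sum.inl v) = true ↔ v ∈ V := by simp [mkConfig]

@[simp] lemma mkConfig_inr (V : Set Vtx) (E : Set Edge) (e : Edge) :
    mkConfig V E (Sum.inr e) = true ↔ e ∈ E := by simp [mkConfig]

namespace IsGrowthPath

variable {V₀ : Set Vtx} {x : Path w}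

lemma jump_mono (h : IsGrowthPath V₀ x) {t : ℝ≥0} (ht : 0 < t) {η : Config}
    (hη : Tendsto x (𝓝[<] t) (𝓝 η)) {i : Site} (hi : η i = true) : x t i = true := by
  rcases h.jump t ht η hη with h1 | ⟨e, -, h1⟩
  · rw [h1, hi]
  · rw [h1]
    rcases i with v | f
    · exact (mkConfig_inl ..).2 (Or.inr hi)
    · exact (mkConfig_inr ..).2 (Or.inr hi)

lemma mono (h : IsGrowthPath V₀ x) {i : Site} {s t : ℝ≥0} (hst : s ≤ t) (hs : x s i = true) :
    x t i = true := by
  by_contra hne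
  obtain ⟨u, hsu, -, hu, η, hη, hηi⟩ := x.exists_jump (b := false) hst (i := i) (by simp [hs])
    (by simpa using hne)
  have := h.jump_mono (pos_of_gt hsu) hη (i := i) (by simpa using hηi)
  simp [hu] at this

lemma monotone (h : IsGrowthPath V₀ x) : Monotone x.toFun := fun _ _ hst i =>
  Bool.le_iff_imp.2 fun hs => h.mono (i := i) hst hs

lemma initial_edge (h : IsGrowthPath V₀ x) (e : Edge) : x 0 (Sum.inr e) = false := by
  simp [h.initial, mkConfig]

/-- If the edge `e` is present at time `t`, then it was added at some positive time `u ≤ t`. -/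
lemma exists_jump_edge (h : IsGrowthPath V₀ x) {e : Edge} {t : ℝ≥0}
    (ht : x t (Sum.inr e) = true) :
    ∃ u, 0 < u ∧ u ≤ t ∧ ∃ η : Config, Tendsto x (𝓝[<] u) (𝓝 η) ∧
      η (Sum.inr e) = false ∧ e ∈ edgeBoundary η.verts ∧
      x u = mkConfig (insert e.source η.verts) (insert e η.edges) := by
  obtain ⟨u, hu0, hut, hu, η, hη, hηi⟩ := x.exists_jump (b := true) (s := 0) zero_le
    (by simp [h.initial_edge]) ht
  refine ⟨u, hu0, hut, η, hη, by simpa using hηi, ?_⟩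
  rcases h.jump u hu0 η hη with h1 | ⟨f, hf, h1⟩
  · exact absurd (h1 ▸ hu) hηi
  · rw [h1, mkConfig_inr] at hu
    rcases hu with rfl | hu
    · exact ⟨hf, h1⟩
    · exact absurd hu hηi

lemma source_mem (h : IsGrowthPath V₀ x) {e : Edge} {t : ℝ≥0} (ht : x t (Sum.inr e) = true) :
    x t (Sum.inl e.source) = true := by
  obtain ⟨u, -, hut, η, -, -, -, hu⟩ := h.exists_jump_edge ht
  exact h.mono hut (by rw [hu]; simp)

lemma target_mem (h : IsGrowthPath V₀ x) {e : Edge} {t : ℝ≥0} (ht : x t (Sum.inr e) = true) :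
    x t (Sum.inl e.target) = true := by
  obtain ⟨u, hu0, hut, η, hη, -, he, -⟩ := h.exists_jump_edge ht
  exact h.mono hut (h.jump_mono hu0 hη he.2.1)

/-- The vertices of a growing graph are the initial ones and the starting points of its edges. -/
lemma vert_iff (h : IsGrowthPath V₀ x) (v : Vtx) (t : ℝ≥0) :
    x t (Sum.inl v) = true ↔ v ∈ V₀ ∨ ∃ e : Edge, e.source = v ∧ x t (Sum.inr e) = true := by
  constructor
  · intro ht
    by_contra! hne
    obtain ⟨u, hu0, hut, hu, η, hη, hηi⟩ := x.exists_jump (b := true) (s := 0) zero_le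
      (by simp [h.initial, hne.1, mkConfig]) ht
    rcases h.jump u hu0 η hη with h1 | ⟨f, hf, h1⟩
    · exact absurd (h1 ▸ hu) hηi
    · have hu' := hu
      rw [h1, mkConfig_inl] at hu
      rcases hu with rfl | hu
      · exact hne.2 f rfl (h.mono hut (by rw [h1]; simp))
      · exact hηi hu
  · rintro (hv | ⟨e, rfl, he⟩)
    · exact h.mono zero_le (by rw [h.initial]; simpa using hv)
    · exact h.source_mem he

end IsGrowthPath

/-! ### Hitting times -/

/-- The first time at which the site `i` is present, which is `∞` if there is no such time. -/
noncomputable def hit (x : Path w) (i : Site) : ℝ≥0∞ := ⨅ (t : ℝ≥0) (_ : x t i = true), (t : ℝ≥0∞)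

lemma hit_le {x : Path w} {i : Site} {t : ℝ≥0} (h : x t i = true) : hit x i ≤ t :=
  iInf₂_le t h

lemma hit_lt_iff {x : Path w} {i : Site} {a : ℝ≥0∞} :
    hit x i < a ↔ ∃ t : ℝ≥0, x t i = true ∧ (t : ℝ≥0∞) < a := by
  simp only [hit, iInf_lt_iff, exists_prop]

lemma coord_eq_false_of_lt_hit {x : Path w} {i : Site} {t : ℝ≥0} (h : (t : ℝ≥0∞) < hit x i) :
    x t i = false := by
  by_contra hne
  exact absurd (hit_le (by simpa using hne)) (not_le.2 h)

/-- For a monotone path the hitting times determine the coordinates; by right continuity this also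
holds at the hitting times. -/
lemma hit_le_iff {x : Path w} (hx : Monotone x.toFun) {i : Site} {t : ℝ≥0} :
    hit x i ≤ t ↔ x t i = true := by
  refine ⟨fun h => ?_, hit_le⟩
  by_contra hne
  obtain ⟨v, hv, hvs⟩ := (mem_nhdsGE_iff_exists_Ico_subset' (lt_add_one t)).1
    (x.eventually_eq_right i t)
  obtain ⟨r, hr, hrv⟩ := hit_lt_iff.1 (h.trans_lt (ENNReal.coe_lt_coe.2 hv))
  have hr' : x r i = x t i := by
    rcases le_total t r with htr | hrt
    · exact hvs ⟨htr, ENNReal.coe_lt_coe.1 hrv⟩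
    · have := Bool.le_iff_imp.1 (hx hrt i) hr
      rw [this, hr]
  exact hne (hr' ▸ hr)

lemma coe_lt_hit_iff {x : Path w} (hx : Monotone x.toFun) {i : Site} {t : ℝ≥0} :
    (t : ℝ≥0∞) < hit x i ↔ x t i = false := by
  rw [← not_le, hit_le_iff hx, Bool.not_eq_true]

namespace IsGrowthPath

variable {V₀ : Set Vtx} {x : Path w}

lemma hit_edge_pos (h : IsGrowthPath V₀ x) (e : Edge) : 0 < hit x (Sum.inr e) :=
  (coe_lt_hit_iff h.monotone (t := 0)).2 (h.initial_edge e)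

/-- Different edges are added at different times. -/
lemma hit_edge_injOn (h : IsGrowthPath V₀ x) {e f : Edge} {t : ℝ≥0}
    (he : hit x (Sum.inr e) = t) (hf : hit x (Sum.inr f) = t) : e = f := by
  have key : ∀ {g : Edge}, hit x (Sum.inr g) = t → ∀ η : Config,
      Tendsto x (𝓝[<] t) (𝓝 η) → η (Sum.inr g) = false ∧ x t (Sum.inr g) = true := by
    intro g hg η hη
    have ht : 0 < t := by
      have := h.hit_edge_pos g
      rw [hg] at this
      exact_mod_cast this
    have : (𝓝[<] t).NeBot := nhdsLT_neBot_of_exists_lt ⟨0, ht⟩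
    obtain ⟨r, hr1, hr2⟩ := ((eventually_coord_eq hη (Sum.inr g)).and self_mem_nhdsWithin).exists
    exact ⟨hr1 ▸ coord_eq_false_of_lt_hit (hg ▸ ENNReal.coe_lt_coe.2 hr2),
      (hit_le_iff h.monotone).1 hg.le⟩
  obtain ⟨η, hη⟩ := x.left_lim t
  have ht : 0 < t := by
    have := h.hit_edge_pos e
    rw [he] at this
    exact_mod_cast this
  obtain ⟨he1, he2⟩ := key he η hη
  obtain ⟨hf1, hf2⟩ := key hf η hη
  rcases h.jump t ht η hη with h1 | ⟨g, -, h1⟩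
  · rw [h1, he1] at he2
    exact absurd he2 (by simp)
  · rw [h1, mkConfig_inr] at he2 hf2
    have hη : ∀ {k : Edge}, η (Sum.inr k) = false → k ∉ η.edges := fun hk hk' => by
      simp [Config.edges, hk] at hk'
    rw [he2.resolve_right (hη he1), hf2.resolve_right (hη hf1)]

end IsGrowthPath

/-! ### The Skorokhod topology -/

lemma rho_summable (w : Weight) (η ζ : Config) :
    Summable fun i => if η i = ζ i then 0 else w.toFun i :=
  w.summable.of_nonneg_of_le (fun i => by split_ifs <;> simp [(w.pos i).le])
    (fun i => by split_ifs <;> simp [(w.pos i).le])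

lemma weight_le_rho {η ζ : Config} {i : Site} (h : η i ≠ ζ i) : w.toFun i ≤ rho w η ζ := by
  have := (rho_summable w η ζ).le_tsum i (fun j _ => by split_ifs <;> simp [(w.pos j).le])
  simpa [rho, h] using this

lemma rho_mono {η ζ η' ζ' : Config} (h : ∀ i, η i = ζ i → η' i = ζ' i) :
    rho w η' ζ' ≤ rho w η ζ := by
  refine (rho_summable w η' ζ').tsum_le_tsum (fun i => ?_) (rho_summable w η ζ)
  by_cases h1 : η i = ζ i
  · simp [h1, h i h1]
  · split_ifs <;> simp [(w.pos i).le]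

lemma isOpen_path_iff {U : Set (Path w)} : IsOpen U ↔
    ∀ x ∈ U, ∃ ε : ℝ≥0∞, 0 < ε ∧ ∀ y, skorokhodDist x y < ε → y ∈ U := Iff.rfl

/-- Continuity on path space only has to be checked on balls. -/
lemma continuous_path_of_forall {w' : Weight} {f : Path w → Path w'}
    (h : ∀ x, ∀ ε : ℝ≥0∞, 0 < ε → ∃ δ : ℝ≥0∞, 0 < δ ∧
      ∀ y, skorokhodDist x y < δ → skorokhodDist (f x) (f y) < ε) : Continuous f := by
  refine continuous_def.2 fun U hU => isOpen_path_iff.2 fun x hx => ?_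
  obtain ⟨ε, hε, hU⟩ := isOpen_path_iff.1 hU (f x) hx
  obtain ⟨δ, hδ, h⟩ := h x ε hε
  exact ⟨δ, hδ, fun y hy => hU _ (h y hy)⟩

lemma skorokhodDist_lt_iff {x y : Path w} {ε : ℝ≥0∞} : skorokhodDist x y < ε ↔
    ∃ φ : ℝ≥0 ≃o ℝ≥0, timeChangeSize φ < ε ∧
      ∫⁻ u in Set.Ioi (0 : ℝ),
        ENNReal.ofReal (Real.exp (-u)) * stoppedDist x y φ u.toNNReal < ε := by
  simp [skorokhodDist, iInf_lt_iff]

lemma stoppedDist_le_one (x y : Path w) (φ : ℝ≥0 ≃o ℝ≥0) (u : ℝ≥0) : stoppedDist x y φ u ≤ 1 :=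
  iSup_le fun _ => by simp

/-- A time change of small size is close to the identity, multiplicatively. -/
lemma timeChange_bounds {φ : ℝ≥0 ≃o ℝ≥0} {δ : ℝ} (h : timeChangeSize φ ≤ ENNReal.ofReal δ)
    (hδ : 0 ≤ δ) (t : ℝ≥0) :
    (φ t : ℝ) ≤ Real.exp δ * t ∧ Real.exp (-δ) * t ≤ φ t := by
  have h0 : φ 0 = 0 := φ.map_bot
  rcases eq_or_ne t 0 with rfl | ht
  · simp [h0]
  have htp : 0 < t := pos_iff_ne_zero.2 ht
  have hφ : 0 < φ t := by rw [← h0]; exact φ.strictMono htp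
  have h1 : ENNReal.ofReal |Real.log (((φ t : ℝ) - φ 0) / ((t : ℝ) - (0 : ℝ≥0)))| ≤
      ENNReal.ofReal δ :=
    (le_iSup₂_of_le (f := fun (t s : ℝ≥0) => ⨆ (_ : t < s),
      ENNReal.ofReal |Real.log (((φ s : ℝ) - φ t) / ((s : ℝ) - t))|) 0 t
      (le_iSup_of_le htp le_rfl)).trans h
  rw [ENNReal.ofReal_le_ofReal_iff hδ, h0] at h1
  simp only [NNReal.coe_zero, sub_zero] at h1
  have htp' : (0 : ℝ) < t := htp
  have hφ' : (0 : ℝ) < φ t := hφ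
  obtain ⟨h2, h3⟩ := abs_le.1 h1
  rw [Real.log_le_iff_le_exp (by positivity), div_le_iff₀ htp'] at h3
  rw [Real.le_log_iff_exp_le (by positivity), le_div_iff₀ htp'] at h2
  exact ⟨h3, h2⟩

/-- Paths at a small Skorokhod distance have the same `i`-th coordinate on a given time interval, up
to a time change close to the identity. -/
lemma exists_timeChange_eq (w : Weight) (i : Site) (T : ℝ≥0) {δ : ℝ} (hδ : 0 < δ) :
    ∃ ε : ℝ≥0∞, 0 < ε ∧ ∀ x y : Path w, skorokhodDist x y < ε → ∃ φ : ℝ≥0 ≃o ℝ≥0,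
      (∀ t : ℝ≥0, (φ t : ℝ) ≤ Real.exp δ * t ∧ Real.exp (-δ) * t ≤ φ t) ∧
      ∀ t ≤ T, x t i = y (φ t) i := by
  set M : ℝ := Real.exp δ * T with hM
  have hM0 : 0 ≤ M := by positivity
  have hTM : (T : ℝ) ≤ M := by
    have := Real.one_le_exp hδ.le
    nlinarith [T.2]
  set c : ℝ := min (w.toFun i) 1 with hc
  have hc0 : 0 < c := lt_min (w.pos i) one_pos
  refine ⟨min (ENNReal.ofReal δ) (ENNReal.ofReal (Real.exp (-(M + 1)) * c)),
    lt_min (by simpa using hδ) (by simpa using by positivity), fun x y hxy => ?_⟩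
  obtain ⟨φ, hφ1, hφ2⟩ := skorokhodDist_lt_iff.1 hxy
  have hb := timeChange_bounds (hφ1.le.trans (min_le_left _ _)) hδ.le
  refine ⟨φ, hb, ?_⟩
  -- at some level `u` beyond all relevant times the stopped distance is too small for the
  -- coordinate `i` to differ
  obtain ⟨u, hu, hlt⟩ : ∃ u ∈ Set.Ioc M (M + 1),
      stoppedDist x y φ u.toNNReal < ENNReal.ofReal c := by
    by_contra! hne
    refine absurd (hφ2.trans_le (min_le_right _ _)) (not_lt.2 ?_)
    calc ENNReal.ofReal (Real.exp (-(M + 1)) * c)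
        = ∫⁻ u in Set.Ioc M (M + 1), ENNReal.ofReal (Real.exp (-(M + 1)) * c) := by simp
      _ ≤ ∫⁻ u in Set.Ioc M (M + 1),
          ENNReal.ofReal (Real.exp (-u)) * stoppedDist x y φ u.toNNReal := by
          refine setLIntegral_mono' measurableSet_Ioc fun u hu => ?_
          rw [ENNReal.ofReal_mul (Real.exp_pos _).le]
          gcongr
          · exact hu.2
          · exact hne u hu
      _ ≤ _ := lintegral_mono_set fun u hu => hM0.trans_lt hu.1
  intro t ht
  have hu0 : 0 ≤ u := hM0.trans hu.1.le
  have ht' : (t : ℝ) ≤ T := ht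
  have h1 : t ≤ u.toNNReal := by
    rw [← NNReal.coe_le_coe, Real.coe_toNNReal _ hu0]
    linarith [hu.1]
  have h2 : φ t ≤ u.toNNReal := by
    rw [← NNReal.coe_le_coe, Real.coe_toNNReal _ hu0]
    have := (hb t).1
    have : Real.exp δ * t ≤ Real.exp δ * T := by gcongr
    linarith [hu.1]
  by_contra hne
  have h3 := (le_iSup (fun t : ℝ≥0 => ENNReal.ofReal (min (rho w (x (min t u.toNNReal))
    (y (min (φ t) u.toNNReal))) 1)) t).trans_lt hlt
  rw [min_eq_left h1, min_eq_left h2, ENNReal.ofReal_lt_ofReal_iff hc0] at h3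
  exact absurd h3 (not_lt.2 (min_le_min_right _ (weight_le_rho hne)))

/-- The hitting time of a site is a continuous functional on path space. -/
lemma continuous_hit (i : Site) : Continuous fun x : Path w => hit x i := by
  refine OrderTopology.continuous_iff.2 fun a => ⟨isOpen_path_iff.2 fun x hx => ?_,
    isOpen_path_iff.2 fun x hx => ?_⟩
  · obtain ⟨b, hab, hbx⟩ := ENNReal.lt_iff_exists_nnreal_btwn.1 (show a < hit x i from hx)
    lift a to ℝ≥0 using hab.ne_top
    have hab : (a : ℝ) < b := ENNReal.coe_lt_coe.1 hab
    obtain ⟨δ, hδ, hlt⟩ : ∃ δ : ℝ, 0 < δ ∧ (a : ℝ) < Real.exp (-δ) * b := by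
      have h1 : Tendsto (fun δ : ℝ => Real.exp (-δ) * b) (𝓝[>] 0) (𝓝 b) := by
        have : Continuous fun δ : ℝ => Real.exp (-δ) * b := by fun_prop
        simpa using (this.tendsto 0).mono_left nhdsWithin_le_nhds
      obtain ⟨δ, h2, h3⟩ := ((h1.eventually (lt_mem_nhds hab)).and self_mem_nhdsWithin).exists
      exact ⟨δ, h3, h2⟩
    obtain ⟨ε, hε, h⟩ := exists_timeChange_eq w i b hδ
    refine ⟨ε, hε, fun y hy => ?_⟩
    obtain ⟨φ, hφ, hxy⟩ := h x y hy
    have h2 : (φ b : ℝ≥0∞) ≤ hit y i := by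
      refine le_iInf₂ fun t ht => ?_
      by_contra hlt'
      have hlt' : φ.symm t < b := by
        rw [OrderIso.symm_apply_lt]
        exact ENNReal.coe_lt_coe.1 (not_le.1 hlt')
      have h3 := hxy _ hlt'.le
      rw [coord_eq_false_of_lt_hit ((ENNReal.coe_lt_coe.2 hlt').trans hbx), φ.apply_symm_apply,
        ht] at h3
      exact absurd h3 (by simp)
    have h3 : a < φ b := hlt.trans_le (hφ b).2
    exact (ENNReal.coe_lt_coe.2 h3).trans_le h2
  · obtain ⟨t, ht, hta⟩ := hit_lt_iff.1 (show hit x i < a from hx)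
    obtain ⟨b, htb, hba⟩ := ENNReal.lt_iff_exists_nnreal_btwn.1 hta
    have htb : (t : ℝ) < b := ENNReal.coe_lt_coe.1 htb
    obtain ⟨δ, hδ, hlt⟩ : ∃ δ : ℝ, 0 < δ ∧ Real.exp δ * t < b := by
      have h1 : Tendsto (fun δ : ℝ => Real.exp δ * t) (𝓝[>] 0) (𝓝 t) := by
        have : Continuous fun δ : ℝ => Real.exp δ * t := by fun_prop
        simpa using (this.tendsto 0).mono_left nhdsWithin_le_nhds
      obtain ⟨δ, h2, h3⟩ := ((h1.eventually (gt_mem_nhds htb)).and self_mem_nhdsWithin).exists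
      exact ⟨δ, h3, h2⟩
    obtain ⟨ε, hε, h⟩ := exists_timeChange_eq w i t hδ
    refine ⟨ε, hε, fun y hy => ?_⟩
    obtain ⟨φ, hφ, hxy⟩ := h x y hy
    have h3 : φ t < b := (hφ t).1.trans_lt hlt
    exact (hit_le ((hxy t le_rfl).symm.trans ht)).trans_lt ((ENNReal.coe_lt_coe.2 h3).trans hba)

/-- Intersection with a fixed graph is a contraction. -/
lemma continuous_inter (G : Config) : Continuous fun x : Path w => x.inter G := by
  refine continuous_path_of_forall fun x ε hε => ⟨ε, hε, fun y hy => ?_⟩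
  obtain ⟨φ, h1, h2⟩ := skorokhodDist_lt_iff.1 hy
  refine skorokhodDist_lt_iff.2 ⟨φ, h1, lt_of_le_of_lt (lintegral_mono fun u => ?_) h2⟩
  refine mul_le_mul_right (iSup_mono fun t => ENNReal.ofReal_le_ofReal
    (min_le_min_right _ (rho_mono fun i hi => ?_))) _
  simp [Path.inter, hi]

lemma lintegral_exp_neg_Ioi (c : ℝ) :
    ∫⁻ u in Set.Ioi c, ENNReal.ofReal (Real.exp (-u)) = ENNReal.ofReal (Real.exp (-c)) := by
  rw [← ofReal_integral_eq_lintegral_ofReal (integrableOn_exp_neg_Ioi c)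
    (ae_of_all _ fun u => (Real.exp_pos _).le), integral_exp_neg_Ioi]

lemma timeChangeSize_refl : timeChangeSize (OrderIso.refl ℝ≥0) = 0 := by
  simp only [timeChangeSize, OrderIso.refl_apply]
  refine le_antisymm (iSup_le fun t => iSup_le fun s => iSup_le fun h => ?_) zero_le
  have : (s : ℝ) - t ≠ 0 := sub_ne_zero.2 (by exact_mod_cast h.ne')
  simp [div_self this]

/-- Freezing a path at its initial state is a contraction, as time changes fix the time zero. -/
lemma continuous_speed_zero : Continuous fun x : Path w => x.speed 0 := by
  refine continuous_path_of_forall fun x ε hε => ⟨ε, hε, fun y hy => ?_⟩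
  obtain ⟨φ, h1, h2⟩ := skorokhodDist_lt_iff.1 hy
  refine skorokhodDist_lt_iff.2 ⟨OrderIso.refl _, by rwa [timeChangeSize_refl],
    lt_of_le_of_lt (lintegral_mono fun u => mul_le_mul_right ?_ _) h2⟩
  refine iSup_le fun t => le_iSup_of_le 0 ?_
  have h0 : φ 0 = 0 := φ.map_bot
  simp [h0, Path.speed]

/-- The time change `t ↦ φ (a t) / a`. -/
noncomputable def rescale (a : ℝ≥0) (ha : 0 < a) (φ : ℝ≥0 ≃o ℝ≥0) : ℝ≥0 ≃o ℝ≥0 :=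
  (OrderIso.mulLeft₀ a ha).trans (φ.trans (OrderIso.mulLeft₀ a ha).symm)

lemma mul_rescale {a : ℝ≥0} (ha : 0 < a) (φ : ℝ≥0 ≃o ℝ≥0) (t : ℝ≥0) :
    a * rescale a ha φ t = φ (a * t) :=
  (OrderIso.mulLeft₀ a ha).apply_symm_apply (φ (a * t))

lemma timeChangeSize_rescale_le {a : ℝ≥0} (ha : 0 < a) (φ : ℝ≥0 ≃o ℝ≥0) :
    timeChangeSize (rescale a ha φ) ≤ timeChangeSize φ := by
  refine iSup_le fun t => iSup_le fun s => iSup_le fun h => ?_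
  refine le_iSup₂_of_le (f := fun (t s : ℝ≥0) => ⨆ (_ : t < s),
      ENNReal.ofReal |Real.log (((φ s : ℝ) - φ t) / ((s : ℝ) - t))|) (a * t) (a * s)
      (le_iSup_of_le (mul_lt_mul_of_pos_left h ha) ?_)
  have ha' : (a : ℝ) ≠ 0 := by exact_mod_cast ha.ne'
  rw [← mul_rescale ha, ← mul_rescale ha]
  simp only [NNReal.coe_mul, ← mul_sub]
  rw [mul_div_mul_left _ _ ha']

lemma stoppedDist_speed_le {a : ℝ≥0} (ha : 0 < a) (φ : ℝ≥0 ≃o ℝ≥0) (x y : Path w) (u : ℝ≥0) :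
    stoppedDist (x.speed a) (y.speed a) (rescale a ha φ) u ≤ stoppedDist x y φ (a * u) := by
  refine iSup_le fun t => le_iSup_of_le (a * t) ?_
  simp only [Path.speed]
  rw [mul_min, mul_min, mul_rescale ha]

/-- Scaling time by a fixed positive factor is continuous. It is not Lipschitz for the Skorokhod
metric, because the weight `exp (-u)` scales as well: the integral over large `u` has to be cut
off. -/
lemma continuous_speed (a : ℝ≥0) : Continuous fun x : Path w => x.speed a := by
  rcases eq_or_ne a 0 with rfl | ha0
  · exact continuous_speed_zero
  have ha : 0 < a := pos_iff_ne_zero.2 ha0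
  have ha' : (0 : ℝ) < a := ha
  refine continuous_path_of_forall fun x ε hε => ?_
  obtain ⟨M, hM0, hM⟩ : ∃ M : ℝ, 0 ≤ M ∧ ENNReal.ofReal (Real.exp (-M)) < ε / 2 := by
    have h1 : Tendsto (fun M : ℝ => ENNReal.ofReal (Real.exp (-M))) atTop (𝓝 0) := by
      have := ENNReal.tendsto_ofReal (Real.tendsto_exp_atBot.comp tendsto_neg_atTop_atBot)
      simpa using this
    obtain ⟨M, h2, h3⟩ := ((h1.eventually (gt_mem_nhds (ENNReal.half_pos hε.ne'))).and
      (eventually_ge_atTop 0)).exists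
    exact ⟨M, h3, h2⟩
  -- `C` bounds the density of the scaled measure `exp (-u) du` on the part `u ≤ M`
  set C : ℝ≥0∞ := ENNReal.ofReal (Real.exp (a * M)) * ENNReal.ofReal (a : ℝ)⁻¹ with hC
  have hC0 : C ≠ 0 := by
    refine mul_ne_zero ?_ ?_
    · simpa using Real.exp_pos _
    · simpa using ha
  have hCtop : C ≠ ∞ := ENNReal.mul_ne_top ENNReal.ofReal_ne_top ENNReal.ofReal_ne_top
  refine ⟨min ε (ε / 2 / C), lt_min hε (ENNReal.div_pos (ENNReal.half_pos hε.ne').ne' hCtop),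
    fun y hy => ?_⟩
  obtain ⟨φ, h1, h2⟩ := skorokhodDist_lt_iff.1 hy
  refine skorokhodDist_lt_iff.2 ⟨rescale a ha φ,
    (timeChangeSize_rescale_le ha φ).trans_lt (h1.trans_le (min_le_left _ _)), ?_⟩
  set D : ℝ → ℝ≥0∞ := fun v => stoppedDist x y φ v.toNNReal with hD
  have hscale : ∫⁻ u in Set.Ioi (0 : ℝ), ENNReal.ofReal (Real.exp (-(a * u))) * D (a * u) =
      ENNReal.ofReal (a : ℝ)⁻¹ * ∫⁻ v in Set.Ioi (0 : ℝ), ENNReal.ofReal (Real.exp (-v)) * D v := by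
    have hmap := Real.map_volume_mul_left ha'.ne'
    let m := (Homeomorph.mulLeft₀ (a : ℝ) ha'.ne').toMeasurableEquiv
    have hm : ∀ u, m u = a * u := fun u => rfl
    have h3 : Set.indicator (Set.Ioi (0 : ℝ))
        (fun u => ENNReal.ofReal (Real.exp (-(a * u))) * D (a * u)) =
        fun u => Set.indicator (Set.Ioi (0 : ℝ))
          (fun v => ENNReal.ofReal (Real.exp (-v)) * D v) (m u) := by
      ext u
      by_cases hu : 0 < u
      · rw [Set.indicator_of_mem (show u ∈ Set.Ioi (0 : ℝ) from hu), hm, Set.indicator_of_mem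
          (show (a : ℝ) * u ∈ Set.Ioi (0 : ℝ) from mul_pos ha' hu)]
      · rw [Set.indicator_of_notMem (show u ∉ Set.Ioi (0 : ℝ) from hu), hm, Set.indicator_of_notMem]
        exact fun h => hu ((mul_pos_iff_of_pos_left ha').1 h)
    rw [← lintegral_indicator measurableSet_Ioi, h3, ← lintegral_map_equiv,
      ← lintegral_indicator measurableSet_Ioi]
    have : Measure.map m volume = ENNReal.ofReal |(a : ℝ)⁻¹| • (volume : Measure ℝ) := hmap
    rw [this, lintegral_smul_measure, abs_of_pos (inv_pos.2 ha'), smul_eq_mul]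
  set F : ℝ → ℝ≥0∞ := fun u => ENNReal.ofReal (Real.exp (-u)) *
    stoppedDist (x.speed a) (y.speed a) (rescale a ha φ) u.toNNReal with hF
  have hsplit : Set.Ioi (0 : ℝ) = Set.Ioc 0 M ∪ Set.Ioi M := (Set.Ioc_union_Ioi_eq_Ioi hM0).symm
  have hle1 : ∫⁻ u in Set.Ioc 0 M, F u ≤
      C * ∫⁻ v in Set.Ioi (0 : ℝ), ENNReal.ofReal (Real.exp (-v)) * D v := by
    rw [hC, mul_assoc, ← hscale, ← lintegral_const_mul' _ _ ENNReal.ofReal_ne_top]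
    refine (setLIntegral_mono' measurableSet_Ioc fun u hu => ?_).trans
      (lintegral_mono_set Set.Ioc_subset_Ioi_self)
    rw [← mul_assoc, ← ENNReal.ofReal_mul (Real.exp_pos _).le, ← Real.exp_add]
    refine mul_le_mul' (ENNReal.ofReal_le_ofReal (Real.exp_le_exp.2 ?_)) ?_
    · nlinarith [hu.1, hu.2]
    · have : ((a : ℝ) * u).toNNReal = a * u.toNNReal := by
        rw [Real.toNNReal_mul (p := (a : ℝ)) a.2, Real.toNNReal_coe]
      rw [hD]
      simp only [this]
      exact stoppedDist_speed_le ha φ x y _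
  have hle2 : ∫⁻ u in Set.Ioi M, F u ≤ ENNReal.ofReal (Real.exp (-M)) := by
    rw [← lintegral_exp_neg_Ioi]
    exact lintegral_mono fun u => mul_le_of_le_one_right' (stoppedDist_le_one _ _ _ _)
  have h4 : C * ∫⁻ v in Set.Ioi (0 : ℝ), ENNReal.ofReal (Real.exp (-v)) * D v ≤ ε / 2 := by
    rw [mul_comm]
    exact (ENNReal.le_div_iff_mul_le (Or.inl hC0) (Or.inl hCtop)).1
      (h2.le.trans (min_le_right _ _))
  calc ∫⁻ u in Set.Ioi 0, F u ≤ (∫⁻ u in Set.Ioc 0 M, F u) + ∫⁻ u in Set.Ioi M, F u := by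
        rw [hsplit]; exact lintegral_union_le _ _ _
    _ < ε / 2 + ε / 2 := by
        refine ENNReal.add_lt_add_of_le_of_lt (ne_top_of_le_ne_top ENNReal.ofReal_ne_top
          (b := ENNReal.ofReal (Real.exp (-0))) ?_) (hle1.trans h4) (hle2.trans_lt hM)
        rw [← lintegral_exp_neg_Ioi]
        exact (lintegral_mono fun u => mul_le_of_le_one_right' (stoppedDist_le_one _ _ _ _)).trans
          (lintegral_mono_set Set.Ioc_subset_Ioi_self)
    _ = ε := ENNReal.add_halves ε

/-! ### Time changes with prescribed values -/

/-- A small Lipschitz perturbation of the identity is a time change of small size. -/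
lemma exists_timeChange_of_lipschitz {η : ℝ≥0} (hη : η ≤ 1 / 2) {ψ : ℝ≥0 → ℝ}
    (hψ : LipschitzWith η ψ) (h0 : ψ 0 = 0) :
    ∃ φ : ℝ≥0 ≃o ℝ≥0, (∀ t, (φ t : ℝ) = t + ψ t) ∧
      timeChangeSize φ ≤ ENNReal.ofReal (2 * η) := by
  have hη' : (η : ℝ) ≤ 1 / 2 := by exact_mod_cast hη
  have hη0 : (0 : ℝ) ≤ η := η.2
  have hlip : ∀ s t : ℝ≥0, t ≤ s → |ψ s - ψ t| ≤ η * ((s : ℝ) - t) := by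
    intro s t hst
    have := hψ.dist_le_mul s t
    rwa [Real.dist_eq, NNReal.dist_eq, abs_of_nonneg (sub_nonneg.2 (NNReal.coe_le_coe.2 hst))]
      at this
  have hpos : ∀ t : ℝ≥0, (t : ℝ) / 2 ≤ t + ψ t := by
    intro t
    have := (abs_le.1 (hlip t 0 zero_le)).1
    rw [h0] at this
    simp only [NNReal.coe_zero, sub_zero] at this
    nlinarith [t.2]
  set f : ℝ≥0 → ℝ≥0 := fun t => (t + ψ t).toNNReal with hf
  have hfc : ∀ t, (f t : ℝ) = t + ψ t := fun t =>
    Real.coe_toNNReal _ (le_trans (by positivity) (hpos t))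
  have hmono : StrictMono f := by
    intro t s hts
    rw [← NNReal.coe_lt_coe, hfc, hfc]
    have h1 := (abs_le.1 (hlip s t hts.le)).1
    have h2 : (t : ℝ) < s := hts
    nlinarith
  have hcont : Continuous f :=
    continuous_real_toNNReal.comp (NNReal.continuous_coe.add hψ.continuous)
  have hsurj : Function.Surjective f := by
    intro y
    have h1 : f 0 ≤ y := by simp [hf, h0]
    have h2 : y ≤ f (2 * y) := by
      rw [← NNReal.coe_le_coe, hfc]
      have := hpos (2 * y)
      push_cast at this ⊢
      linarith
    obtain ⟨t, -, ht⟩ := intermediate_value_Icc (zero_le (a := 2 * y)) hcont.continuousOn ⟨h1, h2⟩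
    exact ⟨t, ht⟩
  refine ⟨hmono.orderIsoOfSurjective f hsurj, hfc, ?_⟩
  refine iSup_le fun t => iSup_le fun s => iSup_le fun hts => ENNReal.ofReal_le_ofReal ?_
  have hts' : (0 : ℝ) < s - t := sub_pos.2 hts
  obtain ⟨h1, h2⟩ := abs_le.1 (hlip s t hts.le)
  simp only [StrictMono.coe_orderIsoOfSurjective, hfc]
  set r : ℝ := ((s : ℝ) + ψ s - (t + ψ t)) / (s - t) with hr
  have hr1 : r ≤ 1 + η := by
    rw [hr, div_le_iff₀ hts']
    nlinarith
  have hr2 : 1 - η ≤ r := by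
    rw [hr, le_div_iff₀ hts']
    nlinarith
  have hr0 : 0 < r := by linarith
  refine abs_le.2 ⟨?_, ?_⟩
  · refine le_trans ?_ (Real.one_sub_inv_le_log_of_pos hr0)
    have : r⁻¹ ≤ 1 + 2 * η := by
      rw [inv_le_comm₀ hr0 (by positivity)]
      refine le_trans ?_ hr2
      rw [inv_le_iff_one_le_mul₀ (by positivity)]
      nlinarith
    linarith
  · linarith [Real.log_le_sub_one_of_pos hr0]

/-- A time change of small size may be prescribed arbitrarily on a finite set of times, provided
that it moves these times by little compared to the gaps between them. -/
lemma exists_timeChange_interpolating (S : Finset ℝ≥0) {η : ℝ≥0} (hη0 : 0 < η)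
    (hη : η ≤ 1 / 2) : ∀ᶠ δ : ℝ in 𝓝[>] 0, ∀ g : ℝ≥0 → ℝ≥0, g 0 = 0 →
      (∀ t ∈ S, |(g t : ℝ) - t| ≤ δ) →
      ∃ φ : ℝ≥0 ≃o ℝ≥0, (∀ t ∈ S, φ t = g t) ∧ timeChangeSize φ ≤ ENNReal.ofReal (2 * η) := by
  set A : Finset ℝ≥0 := insert 0 S with hA
  have hev : ∀ᶠ δ : ℝ in 𝓝[>] 0, ∀ a ∈ A, ∀ b ∈ A, a ≠ b → 2 * δ ≤ η * dist a b := by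
    refine (Filter.eventually_all_finset A).2 fun a _ =>
      (Filter.eventually_all_finset A).2 fun b _ => ?_
    by_cases hab : a = b
    · simp [hab]
    · have h1 : Tendsto (fun δ : ℝ => 2 * δ) (𝓝[>] 0) (𝓝 0) := by
        have : Continuous fun δ : ℝ => 2 * δ := by fun_prop
        simpa using (this.tendsto 0).mono_left nhdsWithin_le_nhds
      have h2 : 0 < η * dist a b := mul_pos hη0 (dist_pos.2 hab)
      filter_upwards [h1.eventually (gt_mem_nhds h2)] with δ hδ _ using hδ.le
  filter_upwards [hev, self_mem_nhdsWithin] with δ hδ hδ0 g hg0 hg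
  have hgA : ∀ a ∈ A, |(g a : ℝ) - a| ≤ δ := by
    intro a ha
    rcases Finset.mem_insert.1 ha with rfl | ha
    · simpa [hg0] using (le_of_lt hδ0)
    · exact hg a ha
  have hlip : LipschitzOnWith η (fun t : ℝ≥0 => (g t : ℝ) - t) A := by
    refine LipschitzOnWith.of_dist_le_mul fun a ha b hb => ?_
    by_cases hab : a = b
    · simp [hab]
    · refine le_trans ?_ (hδ a ha b hb hab)
      rw [Real.dist_eq]
      have h1 := abs_le.1 (hgA a ha)
      have h2 := abs_le.1 (hgA b hb)
      exact abs_le.2 ⟨by linarith, by linarith⟩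
  obtain ⟨ψ, hψ, hψA⟩ := hlip.extend_real
  have h0 : ψ 0 = 0 := by
    rw [← hψA (by simp [hA])]
    simp [hg0]
  obtain ⟨φ, hφ, hsize⟩ := exists_timeChange_of_lipschitz hη hψ h0
  refine ⟨φ, fun t ht => ?_, hsize⟩
  rw [← NNReal.coe_inj, hφ, ← hψA (by simp [hA, ht])]
  ring

/-! ### Paths with nearby jump times are close -/

lemma finite_edges_source (K : Finset Site) :
    {e : Edge | Sum.inr e ∈ K ∨ Sum.inl e.source ∈ K}.Finite := by
  have h1 : {e : Edge | (Sum.inr e : Site) ∈ K}.Finite :=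
    K.finite_toSet.preimage Sum.inr_injective.injOn
  have hV : {v : Vtx | (Sum.inl v : Site) ∈ K}.Finite :=
    K.finite_toSet.preimage Sum.inl_injective.injOn
  have h2 : {e : Edge | (Sum.inl e.source : Site) ∈ K}.Finite := by
    have hfin : (⋃ v ∈ {v : Vtx | (Sum.inl v : Site) ∈ K}, ({v} : Set Vtx) ×ˢ
        (Set.Icc (v.1 - 1) (v.1 + 1) ×ˢ Set.Icc (v.2 - 1) (v.2 + 1))).Finite :=
      hV.biUnion fun v _ => (Set.finite_singleton v).prod
        ((Set.finite_Icc _ _).prod (Set.finite_Icc _ _))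
    refine Set.Finite.subset (hfin.preimage Subtype.val_injective.injOn) fun e he => ?_
    obtain ⟨⟨x, y⟩, hxy⟩ := e
    simp only [Adj] at hxy
    simp only [Set.mem_preimage, Set.mem_iUnion]
    refine ⟨x, he, by simp, ⟨?_, ?_⟩, ⟨?_, ?_⟩⟩ <;>
    nlinarith [sq_nonneg (x.1 - y.1), sq_nonneg (x.2 - y.2)]
  exact h1.union h2

/-- On the set `V` of vertices, the vertices present are those on the horizontal axis and the
starting points of the edges present. -/
def IsRooted (V : Set Vtx) (x : Path w) : Prop :=
  ∀ v ∈ V, ∀ t, x t (Sum.inl v) = true ↔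
    v ∈ line 0 ∨ ∃ e : Edge, e.source = v ∧ x t (Sum.inr e) = true

/-- On a finite set of sites, rooted paths are determined by their edges. -/
lemma IsRooted.coord_eq {K : Finset Site} {x y : Path w} (hx : IsRooted {v | Sum.inl v ∈ K} x)
    (hy : IsRooted {v | Sum.inl v ∈ K} y) {s t : ℝ≥0}
    (h : ∀ e : Edge, Sum.inr e ∈ K ∨ Sum.inl e.source ∈ K → x s (Sum.inr e) = y t (Sum.inr e)) :
    ∀ i ∈ K, x s i = y t i := by
  rintro (v | e) hi
  · rw [Bool.eq_iff_iff, hx v hi, hy v hi]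
    refine or_congr_right (exists_congr fun e => and_congr_right fun hev => ?_)
    rw [h e (Or.inr (by rw [hev]; exact hi))]
  · exact h e (Or.inl hi)

lemma IsRooted.subset {V W : Set Vtx} {x : Path w} (h : IsRooted V x) (hW : W ⊆ V) :
    IsRooted W x := fun v hv => h v (hW hv)

/-- Configurations that agree on a large finite set of sites are close. -/
lemma exists_finset_rho_le (w : Weight) {ε : ℝ} (hε : 0 < ε) : ∃ K : Finset Site,
    ∀ η ζ : Config, (∀ i ∈ K, η i = ζ i) → rho w η ζ ≤ ε := by
  obtain ⟨K, hK⟩ := ((tendsto_tsum_compl_atTop_zero w.toFun).eventually (gt_mem_nhds hε)).exists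
  refine ⟨K, fun η ζ h => le_trans ?_ hK.le⟩
  have h1 : rho w η ζ = ∑' i : {i // i ∉ K}, if η i = ζ i then 0 else w.toFun i := by
    refine (tsum_subtype_eq_of_support_subset (s := {i | i ∉ K})
      (f := fun i => if η i = ζ i then 0 else w.toFun i) fun i hi hiK => ?_).symm
    exact hi (by simp [h i hiK])
  rw [h1]
  refine ((rho_summable w η ζ).subtype _).tsum_le_tsum (fun i => ?_) (w.summable.subtype _)
  split_ifs <;> simp [(w.pos i).le]

/-- The integral in the Skorokhod metric is split into an exceptional set `B` of levels, the other
levels up to `T`, and the levels beyond `T`. -/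
lemma lintegral_exp_neg_mul_le (D : ℝ → ℝ≥0∞) (B : Set ℝ) (hB : MeasurableSet B) (T c : ℝ)
    (h1 : ∀ u, D u ≤ 1) (hD : ∀ u, 0 < u → u ≤ T → u ∉ B → D u ≤ ENNReal.ofReal c) :
    ∫⁻ u in Set.Ioi (0 : ℝ), ENNReal.ofReal (Real.exp (-u)) * D u ≤
      volume B + ENNReal.ofReal c + ENNReal.ofReal (Real.exp (-T)) := by
  have hm : Measurable fun u : ℝ => ENNReal.ofReal (Real.exp (-u)) := by fun_prop
  have hle : ∀ u ∈ Set.Ioi (0 : ℝ), ENNReal.ofReal (Real.exp (-u)) * D u ≤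
      (B.indicator 1 u + ENNReal.ofReal (Real.exp (-u)) * ENNReal.ofReal c) +
        (Set.Ioi T).indicator (fun u => ENNReal.ofReal (Real.exp (-u))) u := by
    intro u hu
    by_cases hT : u ≤ T
    · refine le_trans ?_ le_self_add
      by_cases huB : u ∈ B
      · refine le_trans ?_ le_self_add
        rw [Set.indicator_of_mem huB]
        refine (mul_le_of_le_one_right' (h1 u)).trans ?_
        simpa using (le_of_lt hu)
      · exact le_trans (mul_le_mul_right (hD u hu hT huB) _) le_add_self
    · refine le_trans ?_ le_add_self
      rw [Set.indicator_of_mem (show u ∈ Set.Ioi T from not_le.1 hT)]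
      exact mul_le_of_le_one_right' (h1 u)
  refine (setLIntegral_mono' measurableSet_Ioi hle).trans ?_
  have hB' : Measurable (B.indicator (1 : ℝ → ℝ≥0∞)) := measurable_one.indicator hB
  rw [lintegral_add_right _ (hm.indicator measurableSet_Ioi), lintegral_add_left hB',
    lintegral_mul_const _ hm, lintegral_exp_neg_Ioi]
  refine add_le_add (add_le_add ?_ (by simp)) ?_
  · refine (setLIntegral_le_lintegral _ _).trans ?_
    rw [lintegral_indicator_one hB]
  · refine (setLIntegral_le_lintegral _ _).trans ?_
    rw [lintegral_indicator measurableSet_Ioi, lintegral_exp_neg_Ioi]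

/-- Let `x` be a monotone path whose edges are added at different positive times. A monotone path
which adds finitely many given edges at nearly the same times is close to `x` in the Skorokhod
metric. -/
lemma exists_skorokhodDist_lt_of_hit {x : Path w} (hmono : Monotone x.toFun)
    (hroot : IsRooted Set.univ x) (hpos : ∀ e, 0 < hit x (Sum.inr e))
    (hinj : ∀ (e f : Edge) (t : ℝ≥0), hit x (Sum.inr e) = t → hit x (Sum.inr f) = t → e = f)
    {ε : ℝ≥0∞} (hε : 0 < ε) :
    ∃ (T : ℝ≥0) (δ : ℝ) (K : Finset Site) (F : Finset Edge), 0 < δ ∧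
      ∀ y : Path w, Monotone y.toFun → IsRooted {v | Sum.inl v ∈ K} y →
      (∀ e ∈ F, (∀ s : ℝ≥0, hit x (Sum.inr e) = s → s ≤ T →
          ∃ s' : ℝ≥0, hit y (Sum.inr e) = s' ∧ |(s' : ℝ) - s| ≤ δ) ∧
        ((T : ℝ≥0∞) < hit x (Sum.inr e) → (T : ℝ≥0∞) < hit y (Sum.inr e))) →
      skorokhodDist x y < ε := by
  classical
  obtain ⟨c, hc0, hcε⟩ := ENNReal.lt_iff_exists_nnreal_btwn.1
    (ENNReal.div_pos hε.ne' (by simp : (3 : ℝ≥0∞) ≠ ∞))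
  have hc0 : 0 < c := ENNReal.coe_pos.1 hc0
  have hc0' : (0 : ℝ) < c := hc0
  obtain ⟨K, hK⟩ := exists_finset_rho_le w hc0'
  obtain ⟨T', hT', hT'0⟩ := ((Real.tendsto_exp_neg_atTop_nhds_zero.eventually
    (gt_mem_nhds hc0')).and (eventually_ge_atTop 0)).exists
  lift T' to ℝ≥0 using hT'0 with T
  set F : Finset Edge := (finite_edges_source K).toFinset with hF
  have hFK : ∀ e : Edge, Sum.inr e ∈ K ∨ Sum.inl e.source ∈ K → e ∈ F := fun e he => by
    simpa [hF] using he
  set η : ℝ≥0 := min (c / 2) (1 / 2) with hη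
  have hη0 : 0 < η := lt_min (by positivity) (by positivity)
  set S : Finset ℝ≥0 := F.image fun e => (hit x (Sum.inr e)).toNNReal with hS
  have hδev : ∀ᶠ δ : ℝ in 𝓝[>] 0, (F.card : ℝ) * (2 * δ) < c := by
    have h1 : Tendsto (fun δ : ℝ => (F.card : ℝ) * (2 * δ)) (𝓝[>] 0) (𝓝 0) := by
      have : Continuous fun δ : ℝ => (F.card : ℝ) * (2 * δ) := by fun_prop
      simpa using (this.tendsto 0).mono_left nhdsWithin_le_nhds
    exact h1.eventually (gt_mem_nhds hc0')
  obtain ⟨δ, ⟨hδ1, hδ2⟩, hδ0⟩ := (((exists_timeChange_interpolating S hη0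
    (min_le_right _ _)).and hδev).and self_mem_nhdsWithin).exists
  refine ⟨T, δ, K, F, hδ0, fun y hy hyroot hyhit => ?_⟩
  -- the time change has to map the time at which `x` adds an edge to that at which `y` does
  set g : ℝ≥0 → ℝ≥0 := fun r => if h : ∃ e ∈ F, hit x (Sum.inr e) = r ∧ r ≤ T then
    (hit y (Sum.inr h.choose)).toNNReal else r with hg
  have hgval : ∀ e ∈ F, ∀ s : ℝ≥0, hit x (Sum.inr e) = s → s ≤ T →
      (g s : ℝ≥0∞) = hit y (Sum.inr e) ∧ |(g s : ℝ) - s| ≤ δ := by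
    intro e he s hes hsT
    have h : ∃ e ∈ F, hit x (Sum.inr e) = s ∧ s ≤ T := ⟨e, he, hes, hsT⟩
    have hch : h.choose = e := hinj _ _ s h.choose_spec.2.1 hes
    have hgs : g s = (hit y (Sum.inr e)).toNNReal := by
      simp only [hg]
      rw [dif_pos h, hch]
    obtain ⟨s', hs', hd⟩ := (hyhit e he).1 s hes hsT
    rw [hgs, hs']
    exact ⟨by simp, by simpa using hd⟩
  have hg0 : g 0 = 0 := by
    simp only [hg]
    rw [dif_neg]
    rintro ⟨e, -, he, -⟩
    exact absurd (hpos e) (by simp [he])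
  have hgS : ∀ t ∈ S, |(g t : ℝ) - t| ≤ δ := by
    intro t _
    by_cases h : ∃ e ∈ F, hit x (Sum.inr e) = t ∧ t ≤ T
    · obtain ⟨e, he, h1, h2⟩ := h
      exact (hgval e he t h1 h2).2
    · have : g t = t := by
        simp only [hg]
        rw [dif_neg h]
      simpa [this] using le_of_lt hδ0
  obtain ⟨φ, hφS, hφ⟩ := hδ1 g hg0 hgS
  -- the levels close to a jump, at which the stopped paths may differ
  set B : Set ℝ := ⋃ e ∈ F, Set.Icc ((hit x (Sum.inr e)).toReal - δ)
    ((hit x (Sum.inr e)).toReal + δ) with hB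
  have hBm : MeasurableSet B := F.measurableSet_biUnion fun _ _ => measurableSet_Icc
  have hBvol : volume B ≤ c := by
    refine (measure_biUnion_finset_le F _).trans ?_
    have : ∀ e ∈ F, volume (Set.Icc ((hit x (Sum.inr e)).toReal - δ)
        ((hit x (Sum.inr e)).toReal + δ)) = ENNReal.ofReal (2 * δ) := by
      intro e _
      rw [Real.volume_Icc]
      congr 1
      ring
    rw [Finset.sum_congr rfl this, Finset.sum_const, nsmul_eq_mul,
      ← ENNReal.ofReal_natCast, ← ENNReal.ofReal_mul (by positivity), ← ENNReal.ofReal_coe_nnreal]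
    exact ENNReal.ofReal_le_ofReal hδ2.le
  -- stopping at a level `u` outside of `B` affects both jumps of a pair or none
  have hedge : ∀ u : ℝ≥0, u ≤ T → (u : ℝ) ∉ B → ∀ t : ℝ≥0, ∀ e ∈ F,
      (x (min t u) (Sum.inr e) = true ↔ y (min (φ t) u) (Sum.inr e) = true) := by
    intro u huT huB t e he
    rw [← hit_le_iff hmono, ← hit_le_iff hy]
    rcases le_or_gt (hit x (Sum.inr e)) T with h | h
    · obtain ⟨s, hs⟩ : ∃ s : ℝ≥0, (s : ℝ≥0∞) = hit x (Sum.inr e) :=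
        ⟨_, ENNReal.coe_toNNReal (ne_top_of_le_ne_top ENNReal.coe_ne_top h)⟩
      have hsT : s ≤ T := by rw [← hs] at h; exact ENNReal.coe_le_coe.1 h
      obtain ⟨h1, h2⟩ := hgval e he s hs.symm hsT
      have hφs : φ s = g s := hφS s (Finset.mem_image.2 ⟨e, he, by simp [← hs]⟩)
      rw [← hs, ← h1, ENNReal.coe_le_coe, ENNReal.coe_le_coe, le_min_iff, le_min_iff, ← hφs,
        φ.le_iff_le]
      refine and_congr_right fun _ => ?_
      have hus : (u : ℝ) ∉ Set.Icc ((s : ℝ) - δ) (s + δ) := fun hmem =>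
        huB (Set.mem_biUnion he (by simpa [← hs] using hmem))
      rw [Set.mem_Icc, not_and_or, not_le, not_le] at hus
      rw [hφs, ← NNReal.coe_le_coe, ← NNReal.coe_le_coe]
      obtain ⟨h3, h4⟩ := abs_le.1 h2
      constructor <;> intro h5 <;> rcases hus with h6 | h6 <;> linarith
    · have h' := (hyhit e he).2 h
      have hle : ∀ r : ℝ≥0, ((min r u : ℝ≥0) : ℝ≥0∞) ≤ T := fun r =>
        ENNReal.coe_le_coe.2 ((min_le_right _ _).trans huT)
      exact iff_of_false (not_le.2 ((hle t).trans_lt h)) (not_le.2 ((hle _).trans_lt h'))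
  have hcoord : ∀ u : ℝ≥0, u ≤ T → (u : ℝ) ∉ B → ∀ t : ℝ≥0, ∀ i ∈ K,
      x (min t u) i = y (min (φ t) u) i := by
    intro u huT huB t
    exact (hroot.subset (Set.subset_univ _)).coord_eq hyroot fun e he =>
      Bool.eq_iff_iff.2 (hedge u huT huB t e (hFK e he))
  have hint := lintegral_exp_neg_mul_le (fun u => stoppedDist x y φ u.toNNReal) B hBm T c
    (fun u => stoppedDist_le_one _ _ _ _) (fun u hu0 huT huB => iSup_le fun t => by
      refine ENNReal.ofReal_le_ofReal ((min_le_left _ _).trans (hK _ _ fun i hi => ?_))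
      refine hcoord u.toNNReal (Real.toNNReal_le_iff_le_coe.2 huT) ?_ t i hi
      rwa [Real.coe_toNNReal _ hu0.le])
  have h3 : 3 * (c : ℝ≥0∞) < ε := by
    rw [mul_comm]
    exact (ENNReal.lt_div_iff_mul_lt (Or.inl (by simp)) (Or.inl (by simp))).1 hcε
  refine skorokhodDist_lt_iff.2 ⟨φ, hφ.trans_lt ?_, hint.trans_lt ?_⟩
  · refine lt_of_le_of_lt ?_ h3
    have : (2 : ℝ) * η ≤ c := by
      have : (η : ℝ) ≤ c / 2 := by exact_mod_cast min_le_left (c / 2) (1 / 2)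
      linarith
    refine (ENNReal.ofReal_le_ofReal this).trans ?_
    rw [ENNReal.ofReal_coe_nnreal]
    exact le_mul_of_one_le_left' (by norm_num)
  · refine lt_of_le_of_lt ?_ h3
    have h4 : (3 : ℝ≥0∞) * c = c + c + c := by ring
    rw [h4]
    refine add_le_add (add_le_add hBvol (by simp)) ?_
    rw [← ENNReal.ofReal_coe_nnreal]
    exact ENNReal.ofReal_le_ofReal hT'.le

/-- The hypotheses on `x` are those of `exists_skorokhodDist_lt_of_hit`: closeness to `x` is implied
by agreement with `x` at finitely many sites and times, the times being taken from a given dense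
set. -/
lemma exists_skorokhodDist_lt_of_agree {x : Path w} (hmono : Monotone x.toFun)
    (hroot : IsRooted Set.univ x) (hpos : ∀ e, 0 < hit x (Sum.inr e))
    (hinj : ∀ (e f : Edge) (t : ℝ≥0), hit x (Sum.inr e) = t → hit x (Sum.inr f) = t → e = f)
    {ε : ℝ≥0∞} (hε : 0 < ε) {D : Set ℝ≥0} (hD : Dense D) :
    ∃ (J : Finset ℝ≥0) (K : Finset Site), (J : Set ℝ≥0) ⊆ D ∧
      ∀ y : Path w, Monotone y.toFun → IsRooted {v | Sum.inl v ∈ K} y →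
      (∀ t ∈ J, ∀ i ∈ K, y t i = x t i) → skorokhodDist x y < ε := by
  classical
  obtain ⟨T, δ, K, F, hδ, h⟩ := exists_skorokhodDist_lt_of_hit hmono hroot hpos hinj hε
  have hlocal : ∀ e : Edge, ∃ J : Finset ℝ≥0, (J : Set ℝ≥0) ⊆ D ∧ ∀ y : Path w,
      Monotone y.toFun → (∀ t ∈ J, y t (Sum.inr e) = x t (Sum.inr e)) →
      (∀ s : ℝ≥0, hit x (Sum.inr e) = s → s ≤ T →
          ∃ s' : ℝ≥0, hit y (Sum.inr e) = s' ∧ |(s' : ℝ) - s| ≤ δ) ∧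
        ((T : ℝ≥0∞) < hit x (Sum.inr e) → (T : ℝ≥0∞) < hit y (Sum.inr e)) := by
    intro e
    rcases le_or_gt (hit x (Sum.inr e)) T with hT | hT
    · obtain ⟨s, hs⟩ : ∃ s : ℝ≥0, (s : ℝ≥0∞) = hit x (Sum.inr e) :=
        ⟨_, ENNReal.coe_toNNReal (ne_top_of_le_ne_top ENNReal.coe_ne_top hT)⟩
      have hs0 : 0 < s := by
        have := hpos e
        rw [← hs] at this
        exact_mod_cast this
      obtain ⟨a, haD, ha1, ha2⟩ := hD.exists_between
        (show max ((s : ℝ) - δ).toNNReal 0 < s by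
          refine max_lt ?_ hs0
          rw [← NNReal.coe_lt_coe, Real.coe_toNNReal']
          exact max_lt (by linarith) hs0)
      obtain ⟨b, hbD, hb1, hb2⟩ := hD.exists_between
        (show s < s + δ.toNNReal from lt_add_of_pos_right _ (Real.toNNReal_pos.2 hδ))
      refine ⟨{a, b}, by simp [Set.insert_subset_iff, haD, hbD], fun y hy hyx => ⟨?_, ?_⟩⟩
      · intro s₂ hs₂ _
        obtain rfl : s = s₂ := by rw [← hs] at hs₂; exact ENNReal.coe_inj.1 hs₂
        have hxa : x a (Sum.inr e) = false :=
          coord_eq_false_of_lt_hit (by rw [← hs]; exact ENNReal.coe_lt_coe.2 ha2)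
        have hxb : x b (Sum.inr e) = true :=
          (hit_le_iff hmono).1 (by rw [← hs]; exact ENNReal.coe_le_coe.2 hb1.le)
        have hya := (coe_lt_hit_iff hy).2 ((hyx a (by simp)).trans hxa)
        have hyb := (hit_le_iff hy).2 ((hyx b (by simp)).trans hxb)
        obtain ⟨s', hs'⟩ : ∃ s' : ℝ≥0, (s' : ℝ≥0∞) = hit y (Sum.inr e) :=
          ⟨_, ENNReal.coe_toNNReal (ne_top_of_le_ne_top ENNReal.coe_ne_top hyb)⟩
        refine ⟨s', hs'.symm, ?_⟩
        rw [← hs'] at hya hyb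
        have h1 : (a : ℝ) < s' := ENNReal.coe_lt_coe.1 hya
        have h2 : (s' : ℝ) ≤ b := ENNReal.coe_le_coe.1 hyb
        have h3 : (s : ℝ) - δ < a :=
          (Real.le_coe_toNNReal _).trans_lt (NNReal.coe_lt_coe.2 ((le_max_left _ _).trans_lt ha1))
        have h4 : (b : ℝ) < s + δ := by
          have := NNReal.coe_lt_coe.2 hb2
          rwa [NNReal.coe_add, Real.coe_toNNReal _ hδ.le] at this
        exact abs_le.2 ⟨by linarith, by linarith⟩
      · exact fun h => absurd h (not_lt.2 hT)
    · obtain ⟨c, hc1, hc2⟩ := ENNReal.lt_iff_exists_nnreal_btwn.1 hT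
      obtain ⟨b, hbD, hb1, hb2⟩ := hD.exists_between (ENNReal.coe_lt_coe.1 hc1)
      refine ⟨{b}, by simpa using hbD, fun y hy hyx => ⟨fun s hs hsT => ?_, fun _ => ?_⟩⟩
      · rw [hs] at hT
        exact absurd (ENNReal.coe_le_coe.2 hsT) (not_le.2 hT)
      · have hxb : x b (Sum.inr e) = false :=
          coord_eq_false_of_lt_hit ((ENNReal.coe_lt_coe.2 hb2).trans hc2)
        exact (ENNReal.coe_lt_coe.2 hb1).trans
          ((coe_lt_hit_iff hy).2 ((hyx b (by simp)).trans hxb))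
  choose J hJD hJ using hlocal
  refine ⟨F.biUnion J, K ∪ F.image Sum.inr, by simpa using fun e _ => hJD e,
    fun y hy hyroot hyx => h y hy (fun v hv => hyroot v (Finset.mem_union_left _ hv))
      fun e he => hJ e y hy fun t ht => ?_⟩
  exact hyx t (Finset.mem_biUnion.2 ⟨e, he, ht⟩) _
    (Finset.mem_union_right _ (Finset.mem_image_of_mem _ he))

/-! ### Convergence in distribution through events -/

section Distribution

variable {Ω : ℕ → Type*} [∀ n, MeasurableSpace (Ω n)] {P : (n : ℕ) → Measure (Ω n)}
  [∀ n, IsProbabilityMeasure (P n)] {Ω' : Type*} [MeasurableSpace Ω'] {Q : Measure Ω'}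
  [IsProbabilityMeasure Q] {E : Type*} [TopologicalSpace E] [MeasurableSpace E]
  [OpensMeasurableSpace E] {X : (n : ℕ) → Ω n → E} {Z : Ω' → E}

lemma tendstoInDistribution_of_forall_isOpen (hX : ∀ n, AEMeasurable (X n) (P n))
    (hZ : AEMeasurable Z Q)
    (h : ∀ U, IsOpen U → Q (Z ⁻¹' U) ≤ liminf (fun n => P n (X n ⁻¹' U)) atTop) :
    TendstoInDistribution X atTop Z P Q where
  forall_aemeasurable := hX
  aemeasurable_limit := hZ
  tendsto := by
    refine tendsto_of_forall_isOpen_le_liminf' fun U hU => ?_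
    simp only [ProbabilityMeasure.coe_mk]
    rw [Measure.map_apply_of_aemeasurable hZ hU.measurableSet]
    refine (h U hU).trans_eq ?_
    congr 1
    ext n
    rw [Measure.map_apply_of_aemeasurable (hX n) hU.measurableSet]

lemma le_liminf_of_isOpen [HasOuterApproxClosed E] (h : TendstoInDistribution X atTop Z P Q)
    {U : Set E} (hU : IsOpen U) :
    Q (Z ⁻¹' U) ≤ liminf (fun n => P n (X n ⁻¹' U)) atTop := by
  have := ProbabilityMeasure.le_liminf_measure_open_of_tendsto h.tendsto hU
  simp only [ProbabilityMeasure.coe_mk] at this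
  rw [Measure.map_apply_of_aemeasurable h.aemeasurable_limit hU.measurableSet] at this
  refine this.trans_eq ?_
  congr 1
  ext n
  rw [Measure.map_apply_of_aemeasurable (h.forall_aemeasurable n) hU.measurableSet]

lemma tendsto_real_of_isClopen [HasOuterApproxClosed E] (h : TendstoInDistribution X atTop Z P Q)
    {U : Set E} (hU : IsClopen U) :
    Tendsto (fun n => (P n).real (X n ⁻¹' U)) atTop (𝓝 (Q.real (Z ⁻¹' U))) := by
  have := ProbabilityMeasure.tendsto_measure_of_null_frontier_of_tendsto' h.tendsto (E := U)
    (by simp [hU.frontier_eq])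
  have hm := hU.isOpen.measurableSet
  simp only [ProbabilityMeasure.coe_mk] at this
  rw [Measure.map_apply_of_aemeasurable h.aemeasurable_limit hm] at this
  refine ((ENNReal.tendsto_toReal (measure_ne_top _ _)).comp this).congr fun n => ?_
  simp only [Function.comp]
  rw [Measure.map_apply_of_aemeasurable (h.forall_aemeasurable n) hm]
  rfl

end Distribution

/-- To bound the probability of `{Z ∈ U}` by a constant, it suffices to bound those of events which
eventually contain it. -/
lemma measure_le_of_eventually_mem {Ω' : Type*} [MeasurableSpace Ω'] {Q : Measure Ω'} {U : Set Ω'}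
    {A : ℕ → Set Ω'} {b : ℝ≥0∞}
    (h : ∀ᵐ ω ∂Q, ω ∈ U → ∀ᶠ m in atTop, ω ∈ A m) (hA : ∀ m, Q (A m) ≤ b) : Q U ≤ b := by
  calc Q U ≤ Q (⋃ m, ⋂ k ≥ m, A k) := by
        refine measure_mono_ae ?_
        filter_upwards [h] with ω hω hU
        obtain ⟨m, hm⟩ := eventually_atTop.1 (hω hU)
        exact Set.mem_iUnion.2 ⟨m, Set.mem_iInter₂.2 hm⟩
    _ = ⨆ m, Q (⋂ k ≥ m, A k) := by
        refine Monotone.measure_iUnion fun m n hmn => ?_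
        exact Set.iInter₂_mono' fun k hk => ⟨k, hmn.trans hk, subset_rfl⟩
    _ ≤ b := iSup_le fun m => (measure_mono (Set.iInter₂_subset m le_rfl)).trans (hA m)

/-! ### Absence of fixed jump times -/

/-- Monotone convergence to zero, without any measurability. The lower integral is continuous along
decreasing sequences because it is attained by measurable minorants. -/
lemma tendsto_lintegral_zero_of_antitone {Ω : Type*} [MeasurableSpace Ω] {P : Measure Ω}
    {g : ℕ → Ω → ℝ≥0∞} (hanti : Antitone g)
    (hlim : ∀ ω, g 0 ω ≠ ∞ → Tendsto (fun n => g n ω) atTop (𝓝 0))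
    (hfin : ∫⁻ ω, g 0 ω ∂P ≠ ∞) : Tendsto (fun n => ∫⁻ ω, g n ω ∂P) atTop (𝓝 0) := by
  choose k hkm hkle hkint using fun n => exists_measurable_le_lintegral_eq P (g n)
  set G : ℕ → Ω → ℝ≥0∞ := fun n ω => ⨆ j, k (n + j) ω with hG
  have hGm : ∀ n, Measurable (G n) := fun n => .iSup fun j => hkm _
  have hGle : ∀ n, G n ≤ g n := fun n ω =>
    iSup_le fun j => (hkle (n + j) ω).trans (hanti (Nat.le_add_right n j) ω)
  have hGanti : Antitone G := fun m n hmn ω => iSup_le fun j =>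
    le_iSup_of_le (n - m + j) (by rw [← add_assoc, Nat.add_sub_cancel' hmn])
  have hGint : ∀ n, ∫⁻ ω, G n ω ∂P = ∫⁻ ω, g n ω ∂P := fun n =>
    le_antisymm (lintegral_mono (hGle n))
      (by rw [hkint]; exact lintegral_mono fun ω => le_iSup_of_le 0 le_rfl)
  have hLm : Measurable fun ω => ⨅ n, G n ω := .iInf hGm
  have hL : ∀ᵐ ω ∂P, ⨅ n, G n ω = 0 := by
    have hS : MeasurableSet {ω | ⨅ n, G n ω ≠ 0} := hLm (measurableSet_singleton 0).compl
    have htop : ∀ ω ∈ {ω | ⨅ n, G n ω ≠ 0}, g 0 ω = ∞ := by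
      intro ω hω
      by_contra hne
      refine hω (le_antisymm (ge_of_tendsto' (hlim ω hne) fun n => ?_) zero_le)
      exact (iInf_le _ n).trans (hGle n ω)
    by_contra hne
    refine hfin (top_unique ?_)
    calc (∞ : ℝ≥0∞) = ∞ * P {ω | ⨅ n, G n ω ≠ 0} := (ENNReal.top_mul hne).symm
      _ = ∫⁻ ω in {ω | ⨅ n, G n ω ≠ 0}, ∞ ∂P := by rw [setLIntegral_const]
      _ ≤ ∫⁻ ω in {ω | ⨅ n, G n ω ≠ 0}, g 0 ω ∂P :=
          setLIntegral_mono' hS fun ω hω => (htop ω hω).ge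
      _ ≤ ∫⁻ ω, g 0 ω ∂P := setLIntegral_le_lintegral _ _
  have := lintegral_tendsto_of_tendsto_of_antitone (μ := P) (f := G) (F := fun ω => ⨅ n, G n ω)
    (fun n => (hGm n).aemeasurable) (ae_of_all _ fun ω m n hmn => hGanti hmn ω)
    (by rw [hGint]; exact hfin)
    (ae_of_all _ fun ω => tendsto_atTop_iInf fun m n hmn => hGanti hmn ω)
  rw [lintegral_congr_ae hL, lintegral_zero] at this
  simpa only [hGint] using this

lemma measurableSet_coord {Ω : Type*} [MeasurableSpace Ω] {X : Ω → Path w}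
    (hm : ∀ t, Measurable fun ω => X ω t) (t : ℝ≥0) (i : Site) :
    MeasurableSet {ω | X ω t i = true} :=
  ((measurable_pi_apply i).comp (hm t)) (measurableSet_singleton true)

namespace IsEdgeGrowth

variable {Ω : Type*} [MeasurableSpace Ω] {P : Measure Ω} [IsProbabilityMeasure P]
  {rate : Set Vtx → Edge → ℝ≥0∞} {V₀ : Set Vtx} {X : Ω → Path w}

/-- The probability that a given edge is present is a continuous function of time: by absolute
continuity, the time integral of its rate is small over small time intervals. -/
lemma continuous_prob_edge (h : IsEdgeGrowth P rate V₀ X) (e : Edge) :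
    Continuous fun t => P.real {ω | X ω t (Sum.inr e) = true} := by
  classical
  set f : Ω → ℝ → ℝ≥0∞ := fun ω u => if e ∈ edgeBoundary (X ω u.toNNReal).verts
    then rate (X ω u.toNNReal).verts e else 0 with hf
  refine Metric.continuous_iff.2 fun t ε hε => ?_
  set a : ℕ → ℝ≥0 := fun n => t - 1 / (n + 1) with ha
  set b : ℕ → ℝ≥0 := fun n => t + 1 / (n + 1) with hb
  set S : ℕ → Set ℝ := fun n => Set.Ioc (a n : ℝ) (b n) with hS
  have hinv : Antitone fun n : ℕ => (1 : ℝ≥0) / (n + 1) := fun m n hmn => by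
    dsimp only
    gcongr
  have hab : ∀ n, a n ≤ b n := fun n => tsub_le_self.trans le_self_add
  have hSanti : Antitone S := fun m n hmn => Set.Ioc_subset_Ioc
    (NNReal.coe_le_coe.2 (tsub_le_tsub_left (hinv hmn) t))
    (NNReal.coe_le_coe.2 (add_le_add_right (hinv hmn) t))
  have hSinter : volume (⋂ n, S n) = 0 := by
    refine measure_mono_null (t := {(t : ℝ)}) (fun u hu => ?_) (by simp)
    have h0 := tendsto_one_div_add_atTop_nhds_zero_nat (𝕜 := ℝ)
    have hu' : ∀ n : ℕ, (t : ℝ) - 1 / (n + 1) ≤ u ∧ u ≤ t + 1 / (n + 1) := fun n => by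
      obtain ⟨h1, h2⟩ := Set.mem_iInter.1 hu n
      refine ⟨le_trans ?_ h1.le, by simpa [hb] using h2⟩
      have := NNReal.coe_le_coe.2 (tsub_le_iff_right.1 (le_refl (t - 1 / ((n : ℝ≥0) + 1))))
      push_cast at this
      simp only [ha]
      linarith
    have h1 : (t : ℝ) ≤ u := by
      have := h0.const_sub (t : ℝ)
      rw [sub_zero] at this
      exact le_of_tendsto' this fun n => (hu' n).1
    have h2 : u ≤ t := by
      have := h0.const_add (t : ℝ)
      rw [add_zero] at this
      exact ge_of_tendsto' this fun n => (hu' n).2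
    exact le_antisymm h2 h1
  set g : ℕ → Ω → ℝ≥0∞ := fun n ω => ∫⁻ u in S n, f ω u with hg
  have hgP : ∀ n, ∫⁻ ω, g n ω ∂P = P {ω | e ∈ (X ω (b n)).edges ∧ e ∉ (X ω (a n)).edges} := by
    intro n
    have := h.intensity e (a n) (b n) (hab n) Set.univ MeasurableSet.univ
    rw [Set.univ_inter, setLIntegral_univ] at this
    exact this.symm
  have hlim : Tendsto (fun n => ∫⁻ ω, g n ω ∂P) atTop (𝓝 0) := by
    refine tendsto_lintegral_zero_of_antitone
      (fun m n hmn ω => lintegral_mono_set (hSanti hmn)) (fun ω hω => ?_) ?_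
    · have hgd : ∀ n, g n ω = (volume.withDensity (f ω)) (S n) := fun n =>
        (withDensity_apply _ measurableSet_Ioc).symm
      have := tendsto_measure_iInter_atTop (μ := volume.withDensity (f ω)) (s := S)
        (fun n => measurableSet_Ioc.nullMeasurableSet) hSanti ⟨0, by rwa [← hgd]⟩
      rw [withDensity_absolutelyContinuous _ _ hSinter] at this
      simpa only [hgd, Function.comp_def] using this
    · rw [hgP]
      exact measure_ne_top _ _
  obtain ⟨n, hn⟩ := (hlim.eventually (gt_mem_nhds (ENNReal.ofReal_pos.2 hε))).exists
  have hjump : P.real {ω | e ∈ (X ω (b n)).edges ∧ e ∉ (X ω (a n)).edges} < ε := by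
    rw [hgP] at hn
    exact (ENNReal.ofReal_lt_ofReal_iff hε).1 (by rwa [ofReal_measureReal])
  have hle : ∀ s r : ℝ≥0, s ≤ b n → a n ≤ r →
      P.real {ω | X ω s (Sum.inr e) = true} - P.real {ω | X ω r (Sum.inr e) = true} < ε := by
    intro s r hs hr
    refine lt_of_le_of_lt (sub_le_iff_le_add.2 ?_) hjump
    refine le_trans ?_ (measureReal_union_le _ _)
    refine ENNReal.toReal_mono (measure_ne_top _ _) (measure_mono_ae ?_)
    filter_upwards [h.ae_isGrowthPath] with ω hω hωs
    by_cases hωa : X ω (a n) (Sum.inr e) = true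
    · exact Or.inr (hω.mono hr hωa)
    · exact Or.inl ⟨hω.mono hs hωs, hωa⟩
  refine ⟨1 / (n + 1), by positivity, fun s hs => ?_⟩
  rw [NNReal.dist_eq] at hs
  obtain ⟨h1, h2⟩ := abs_lt.1 hs
  have hsb : s ≤ b n := by
    rw [← NNReal.coe_le_coe]
    simp only [hb]
    push_cast
    linarith
  have has : a n ≤ s := by
    rw [ha]
    refine tsub_le_iff_right.2 ?_
    rw [← NNReal.coe_le_coe]
    push_cast
    linarith
  rw [Real.dist_eq, abs_lt]
  have h3 := hle s t hsb tsub_le_self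
  have h4 := hle t s le_self_add has
  exact ⟨by linarith, h3⟩

end IsEdgeGrowth

section RandomGrowth

variable {Ω : Type*} [MeasurableSpace Ω] {P : Measure Ω} [IsProbabilityMeasure P] {V₀ : Set Vtx}
  {X : Ω → Path w}

/-- The probability that `e` is added during `(s, t]`. -/
lemma prob_edge_added (hX : ∀ᵐ ω ∂P, IsGrowthPath V₀ (X ω))
    (hm : ∀ t, Measurable fun ω => X ω t) (e : Edge) {s t : ℝ≥0} (hst : s ≤ t) :
    P.real {ω | X ω s (Sum.inr e) ≠ X ω t (Sum.inr e)} =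
      P.real {ω | X ω t (Sum.inr e) = true} - P.real {ω | X ω s (Sum.inr e) = true} := by
  have h1 : P.real {ω | X ω s (Sum.inr e) ≠ X ω t (Sum.inr e)} =
      P.real ({ω | X ω t (Sum.inr e) = true} \ {ω | X ω s (Sum.inr e) = true}) := by
    refine measureReal_congr ?_
    filter_upwards [hX] with ω hω
    have := hω.mono (i := Sum.inr e) hst
    refine propext ?_
    change X ω s (Sum.inr e) ≠ X ω t (Sum.inr e) ↔
      X ω t (Sum.inr e) = true ∧ ¬ X ω s (Sum.inr e) = true
    cases h2 : X ω s (Sum.inr e) <;> cases h3 : X ω t (Sum.inr e) <;> simp_all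
  have h2 : P.real ({ω | X ω t (Sum.inr e) = true} ∩ {ω | X ω s (Sum.inr e) = true}) =
      P.real {ω | X ω s (Sum.inr e) = true} := by
    refine measureReal_congr ?_
    filter_upwards [hX] with ω hω
    exact propext ⟨fun h => h.2, fun h => ⟨hω.mono hst h, h⟩⟩
  have h3 := measureReal_inter_add_sdiff (μ := P) (s := {ω | X ω t (Sum.inr e) = true})
    (measurableSet_coord hm s (Sum.inr e))
  linarith

/-- No edge is added at a fixed time. -/
lemma ae_hit_ne (hX : ∀ᵐ ω ∂P, IsGrowthPath V₀ (X ω))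
    (hm : ∀ t, Measurable fun ω => X ω t) {e : Edge}
    (hc : Continuous fun t => P.real {ω | X ω t (Sum.inr e) = true}) (t : ℝ≥0) :
    ∀ᵐ ω ∂P, hit (X ω) (Sum.inr e) ≠ t := by
  rcases eq_or_ne t 0 with rfl | ht
  · filter_upwards [hX] with ω hω using (hω.hit_edge_pos e).ne'
  have ht0 : 0 < t := pos_iff_ne_zero.2 ht
  have hreal : P.real {ω | hit (X ω) (Sum.inr e) = t} = 0 := by
    refine le_antisymm (le_of_forall_pos_le_add fun ε hε => ?_) measureReal_nonneg
    have hc' := (hc.tendsto t).mono_left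
      (nhdsWithin_le_nhds (s := Set.Iio t))
    have : (𝓝[<] t).NeBot := nhdsLT_neBot_of_exists_lt ⟨0, ht0⟩
    obtain ⟨s, hs1, hs2⟩ := ((hc'.eventually (lt_mem_nhds (sub_lt_self _ hε))).and
      self_mem_nhdsWithin).exists
    have hle : P.real {ω | hit (X ω) (Sum.inr e) = t} ≤
        P.real {ω | X ω s (Sum.inr e) ≠ X ω t (Sum.inr e)} := by
      refine ENNReal.toReal_mono (measure_ne_top _ _) (measure_mono_ae ?_)
      filter_upwards [hX] with ω hω hωt
      have hωt : hit (X ω) (Sum.inr e) = t := hωt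
      have h1 : X ω t (Sum.inr e) = true := (hit_le_iff hω.monotone).1 hωt.le
      have h2 : X ω s (Sum.inr e) = false :=
        coord_eq_false_of_lt_hit (hωt ▸ ENNReal.coe_lt_coe.2 hs2)
      change X ω s (Sum.inr e) ≠ X ω t (Sum.inr e)
      simp [h1, h2]
    rw [prob_edge_added hX hm e (le_of_lt hs2)] at hle
    linarith
  rw [measureReal_eq_zero_iff] at hreal
  exact compl_mem_ae_iff.2 hreal

end RandomGrowth

/-! ### The stationary process stays in the upper half plane -/

lemma ae_walkLaw_step : ∀ᵐ ξ ∂walkLaw, ∀ i, -1 ≤ (ξ i).2 := by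
  refine ae_all_iff.2 fun i => ?_
  have h : ∀ᵐ v ∂stepLaw.toMeasure, -1 ≤ v.2 := by
    rw [ae_iff, PMF.toMeasure_apply_eq_zero_iff _ (Set.to_countable _).measurableSet]
    refine Set.disjoint_left.2 fun v hv hv' => hv' ?_
    rw [stepLaw, PMF.mem_support_uniformOfFinset_iff] at hv
    simp only [Finset.mem_insert, Finset.mem_singleton] at hv
    rcases hv with rfl | rfl | rfl | rfl <;> simp
  exact (measurePreserving_eval_infinitePi (fun _ : ℕ => stepLaw.toMeasure)
    i).quasiMeasurePreserving.ae h

/-- A walk coming from above cannot use an edge that starts below the horizontal axis before it has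
visited the axis. -/
lemma hitProb_eq_zero {A : Set Vtx} (hA : line 0 ⊆ A) {e : Edge} (he : e.source.2 < 0) {z : Vtx}
    (hz : 1 ≤ z.2) : hitProb A e z = 0 := by
  refine measure_mono_null (t := {ξ | ¬ ∀ i, -1 ≤ (ξ i).2}) ?_ ae_walkLaw_step
  rintro ξ ⟨k, ⟨hk1, -, hk⟩, -, hke⟩ hξ
  have hneg : ∃ n, (walk z ξ n).2 ≤ 0 := ⟨k - 1, by rw [hke]; exact he.le⟩
  have hstep : ∀ n, (walk z ξ n).2 - 1 ≤ (walk z ξ (n + 1)).2 := by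
    intro n
    have := hξ n
    simp only [walk, Finset.sum_range_succ, Prod.snd_add]
    linarith
  classical
  have h0 : Nat.find hneg ≠ 0 := fun h0 => by
    have := Nat.find_spec hneg
    rw [h0] at this
    simp only [walk, Finset.range_zero, Finset.sum_empty, add_zero] at this
    omega
  obtain ⟨j, hj⟩ := Nat.exists_eq_succ_of_ne_zero h0
  have h1 : 0 < (walk z ξ j).2 := not_le.1 (Nat.find_min hneg (by omega))
  have h2 := Nat.find_spec hneg
  have h3 := hstep j
  rw [hj] at h2
  have h4 : Nat.find hneg ≤ k - 1 := Nat.find_min' hneg (by rw [hke]; exact he.le)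
  refine hk (j + 1) (by omega) (by omega) (hA ?_)
  change (walk z ξ (j + 1)).2 = ((0 : ℕ) : ℤ)
  simp only [Nat.succ_eq_add_one] at h2
  push_cast
  omega

lemma statHarmonic_eq_zero (B : Set Vtx) {e : Edge} (he : e.source.2 < 0) :
    statHarmonic B e = 0 := by
  refine Tendsto.limUnder_eq (tendsto_const_nhds.congr' ?_)
  filter_upwards [eventually_ge_atTop 1] with N hN
  rw [statHarmonicAt, eq_comm, ENNReal.tsum_eq_zero]
  rintro ⟨z, hz, -⟩
  refine hitProb_eq_zero Set.subset_union_right he ?_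
  have : z.2 = N := hz
  simp only [this]
  exact_mod_cast hN

lemma le_halfGraph_iff {η : Config} : η ≤ halfGraph ↔
    (∀ v : Vtx, η (Sum.inl v) = true → 0 ≤ v.2) ∧
      ∀ e : Edge, η (Sum.inr e) = true → 0 ≤ e.source.2 ∧ 0 ≤ e.target.2 := by
  constructor
  · intro h
    refine ⟨fun v hv => ?_, fun e he => ?_⟩
    · simpa [halfGraph, inducedGraph, upperHalf] using Bool.le_iff_imp.1 (h (Sum.inl v)) hv
    · simpa [halfGraph, inducedGraph, upperHalf] using Bool.le_iff_imp.1 (h (Sum.inr e)) he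
  · rintro ⟨h1, h2⟩ (v | e)
    · exact Bool.le_iff_imp.2 fun hv => by
        simpa [halfGraph, inducedGraph, upperHalf] using h1 v hv
    · exact Bool.le_iff_imp.2 fun he => by
        simpa [halfGraph, inducedGraph, upperHalf] using h2 e he

lemma IsInfiniteSDLA.ae_le_halfGraph {Ω : Type*} [MeasurableSpace Ω] {Q : Measure Ω}
    {X : Ω → Path w} (h : IsInfiniteSDLA Q X) : ∀ᵐ ω ∂Q, ∀ t, X ω t ≤ halfGraph := by
  have hgrow : IsEdgeGrowth Q statHarmonic (line 0) X := h
  have hedge : ∀ᵐ ω ∂Q, ∀ (e : Edge) (n : ℕ), e.source.2 < 0 →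
      ¬ (X ω n (Sum.inr e) = true ∧ ¬ X ω 0 (Sum.inr e) = true) := by
    refine ae_all_iff.2 fun e => ae_all_iff.2 fun n => ?_
    by_cases he : e.source.2 < 0
    · have := hgrow.intensity e 0 n zero_le Set.univ MeasurableSet.univ
      simp only [statHarmonic_eq_zero _ he, ite_self, lintegral_zero, Set.univ_inter] at this
      filter_upwards [compl_mem_ae_iff.2 this] with ω hω _ using hω
    · exact ae_of_all _ fun ω h => absurd h he
  filter_upwards [hgrow.ae_isGrowthPath, hedge] with ω hω hωe t
  have hsource : ∀ e : Edge, X ω t (Sum.inr e) = true → 0 ≤ e.source.2 := by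
    intro e he
    by_contra hneg
    obtain ⟨n, hn⟩ := exists_nat_ge t
    exact hωe e n (not_le.1 hneg) ⟨hω.mono hn he, by simp [hω.initial_edge]⟩
  have hvert : ∀ v : Vtx, X ω t (Sum.inl v) = true → 0 ≤ v.2 := by
    intro v hv
    rcases (hω.vert_iff v t).1 hv with h0 | ⟨e, rfl, he⟩
    · have : v.2 = ((0 : ℕ) : ℤ) := h0
      simp [this]
    · exact hsource e he
  exact le_halfGraph_iff.2 ⟨hvert, fun e he => ⟨hsource e he, hvert _ (hω.target_mem he)⟩⟩

/-! ### Growth processes and their limit -/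

lemma IsGrowthPath.speed {V₀ : Set Vtx} {x : Path w} (h : IsGrowthPath V₀ x) {c : ℝ≥0}
    (hc : 0 < c) : IsGrowthPath V₀ (x.speed c) where
  initial := by simpa [Path.speed] using h.initial
  jump t ht η hη := by
    refine h.jump (c * t) (mul_pos hc ht) η ?_
    obtain ⟨ζ, hζ⟩ := x.left_lim (c * t)
    have hlim : Tendsto (fun s : ℝ≥0 => c * s) (𝓝[<] t) (𝓝[<] (c * t)) := by
      refine tendsto_nhdsWithin_iff.2 ⟨tendsto_nhdsWithin_of_tendsto_nhds
        ((continuous_const_mul c).tendsto t), ?_⟩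
      filter_upwards [self_mem_nhdsWithin] with s hs
      exact mul_lt_mul_of_pos_left hs hc
    have : (𝓝[<] t).NeBot := nhdsLT_neBot_of_exists_lt ⟨0, ht⟩
    rwa [tendsto_nhds_unique hη (hζ.comp hlim)]

/-- The properties of the processes `X n` and of the candidate limit `Z` on which the comparison of
the modes of convergence rests. All processes are monotone, stay in the upper half plane and start
without edges. On every finite set of sites the vertices of `X n` are, for large `n`, those of the
axis together with the starting points of the edges of `X n`. The limit adds edges one at a time,
and never at a fixed time. -/
structure IsGrowthApproximation {Ω : ℕ → Type*} [∀ n, MeasurableSpace (Ω n)]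
    (P : (n : ℕ) → Measure (Ω n)) {Ω' : Type*} [MeasurableSpace Ω'] (Q : Measure Ω')
    (X : (n : ℕ) → Ω n → Path w) (Z : Ω' → Path w) : Prop where
  measurable : ∀ n, Measurable (X n)
  measurable_eval : ∀ n t, Measurable fun ω => X n ω t
  monotone : ∀ n, ∀ᵐ ω ∂P n, Monotone (X n ω).toFun
  rooted : ∀ K : Finset Site, ∀ᶠ n in atTop, ∀ᵐ ω ∂P n, IsRooted {v | Sum.inl v ∈ K} (X n ω)
  initial_edge : ∀ n, ∀ᵐ ω ∂P n, ∀ e, X n ω 0 (Sum.inr e) = false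
  le_halfGraph : ∀ n ω t, X n ω t ≤ halfGraph
  measurable_limit : Measurable Z
  measurable_eval_limit : ∀ t, Measurable fun ω => Z ω t
  growth_limit : ∀ᵐ ω ∂Q, IsGrowthPath (line 0) (Z ω)
  le_halfGraph_limit : ∀ᵐ ω ∂Q, ∀ t, Z ω t ≤ halfGraph
  continuous_limit : ∀ e, Continuous fun t => Q.real {ω | Z ω t (Sum.inr e) = true}

lemma IsGrowthPath.isRooted {x : Path w} (h : IsGrowthPath (line 0) x) (V : Set Vtx) :
    IsRooted V x := fun v _ t => h.vert_iff v t

/-- The part in the upper half plane of a growing graph is rooted away from the part of the axis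
which is not present from the beginning. -/
lemma IsGrowthPath.isRooted_inter_halfGraph {V₀ V : Set Vtx} {x : Path w} (h : IsGrowthPath V₀ x)
    (h1 : V₀ ⊆ line 0) (h2 : V ∩ line 0 ⊆ V₀) : IsRooted V (x.inter halfGraph) := by
  intro v hv t
  have hval : ∀ i, (x.inter halfGraph) t i = true ↔ x t i = true ∧ halfGraph i = true := fun i => by
    change (x t i && halfGraph i) = true ↔ _
    exact Bool.and_eq_true_iff
  have hhv : halfGraph (Sum.inl v) = true ↔ 0 ≤ v.2 := by
    simp [halfGraph, inducedGraph, upperHalf]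
  have hhe : ∀ e : Edge, halfGraph (Sum.inr e) = true ↔ 0 ≤ e.source.2 ∧ 0 ≤ e.target.2 :=
    fun e => by simp [halfGraph, inducedGraph, upperHalf]
  have hline : v ∈ line 0 ↔ v.2 = 0 := by simp [line]
  simp only [hval, hhv, hhe, hline]
  constructor
  · rintro ⟨hx, hv0⟩
    rcases hv0.eq_or_lt with h0 | hpos
    · exact Or.inl h0.symm
    · rcases (h.vert_iff v t).1 hx with hV | ⟨e, rfl, he⟩
      · exact Or.inl (hline.1 (h1 hV))
      · refine Or.inr ⟨e, rfl, he, hv0, ?_⟩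
        -- an edge starting at height at least one cannot leave the upper half plane
        have := e.2
        simp only [Adj] at this
        simp only [Edge.source] at hpos
        simp only [Edge.target]
        nlinarith [sq_nonneg (e.1.1.1 - e.1.2.1)]
  · rintro (h0 | ⟨e, rfl, he, hs, -⟩)
    · exact ⟨(h.vert_iff v t).2 (Or.inl (h2 ⟨hv, hline.2 h0⟩)), h0.ge⟩
    · exact ⟨h.source_mem he, hs⟩

lemma isGrowthApproximation {Ω : ℕ → Type*} [∀ n, MeasurableSpace (Ω n)]
    {P : (n : ℕ) → Measure (Ω n)}
    {Ω' : Type*} [MeasurableSpace Ω'] {Q : Measure Ω'} [IsProbabilityMeasure Q]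
    {EA : (n : ℕ) → Ω n → Path w} (hEA : ∀ n, IsEDLA (P n) (segment n) (EA n))
    {SA : Ω' → Path w} (hSA : IsInfiniteSDLA Q SA) {c : ℝ≥0} (hc : 0 < c) :
    IsGrowthApproximation P Q (fun n ω => ((EA n ω).speed n).inter halfGraph)
      (fun ω => (SA ω).speed c) := by
  have hE : ∀ n, IsEdgeGrowth (P n) edgeHarmonic (segment n) (EA n) := hEA
  have hS : IsEdgeGrowth Q statHarmonic (line 0) SA := hSA
  have hinf : Measurable fun η : Config => η ⊓ halfGraph :=
    measurable_pi_lambda _ fun i =>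
      (measurable_of_finite fun b : Bool => b ⊓ halfGraph i).comp (measurable_pi_apply i)
  refine ⟨fun n => ?_, fun n t => hinf.comp ((hE n).measurable_eval _), fun n => ?_, fun K => ?_,
    fun n => ?_, fun n ω t => inf_le_right, ?_, fun t => hS.measurable_eval _, ?_, ?_, fun e => ?_⟩
  · exact ((continuous_inter halfGraph).comp (continuous_speed n)).measurable.comp
      (hE n).measurable
  · filter_upwards [(hE n).ae_isGrowthPath] with ω hω s t hst
    exact inf_le_inf_right _ (hω.monotone (mul_le_mul_right hst _))
  · have hfin : {v : Vtx | (Sum.inl v : Site) ∈ K}.Finite :=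
      K.finite_toSet.preimage Sum.inl_injective.injOn
    obtain ⟨N, hN⟩ := (hfin.image fun v => |v.1|).bddAbove
    filter_upwards [eventually_ge_atTop N.toNat, eventually_gt_atTop 0] with n hn hn0
    filter_upwards [(hE n).ae_isGrowthPath] with ω hω
    refine (hω.speed (by exact_mod_cast hn0)).isRooted_inter_halfGraph
      (fun v hv => by simpa [line] using hv.2.2) fun v ⟨hv, hv0⟩ => ?_
    have h1 : |v.1| ≤ n :=
      (hN (Set.mem_image_of_mem _ hv)).trans ((Int.self_le_toNat N).trans (by exact_mod_cast hn))
    obtain ⟨h2, h3⟩ := abs_le.1 h1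
    exact ⟨h2, h3, by simpa [line] using hv0⟩
  · filter_upwards [(hE n).ae_isGrowthPath] with ω hω e
    have : EA n ω (n * 0) (Sum.inr e) = false := by rw [mul_zero]; exact hω.initial_edge e
    change (EA n ω (n * 0) (Sum.inr e) && halfGraph (Sum.inr e)) = false
    rw [this, Bool.false_and]
  · exact (continuous_speed c).measurable.comp hS.measurable
  · filter_upwards [hS.ae_isGrowthPath] with ω hω using hω.speed hc
  · filter_upwards [hSA.ae_le_halfGraph] with ω hω t using hω _
  · exact (hS.continuous_prob_edge e).comp (continuous_const_mul c)

/-- A finite exhaustion of the sites. -/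
lemma exists_exhaustion : ∃ K : ℕ → Finset Site,
    ∀ L : Finset Site, ∀ᶠ m in atTop, L ⊆ K m := by
  classical
  have : Nonempty Site := ⟨Sum.inl 0⟩
  obtain ⟨f, hf⟩ := exists_surjective_nat Site
  refine ⟨fun m => (Finset.range m).image f, fun L => ?_⟩
  have : ∀ i ∈ L, ∀ᶠ m in atTop, i ∈ (Finset.range m).image f := by
    intro i _
    obtain ⟨n, rfl⟩ := hf i
    filter_upwards [eventually_gt_atTop n] with m hm
    exact Finset.mem_image_of_mem f (Finset.mem_range.2 hm)
  filter_upwards [(Filter.eventually_all_finset L).2 this] with m hm i hi using hm i hi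

lemma exists_finset_cylinder {k : ℕ} {U : Set (Fin k → Config)} (hU : IsOpen U)
    {r : Fin k → Config} (hr : r ∈ U) :
    ∃ K : Finset Site, ∀ r' : Fin k → Config, (∀ j, ∀ i ∈ K, r' j i = r j i) → r' ∈ U := by
  classical
  obtain ⟨u, hu, huU⟩ := isOpen_pi_iff'.1 hU r hr
  choose I v hv hvu using fun j => isOpen_pi_iff.1 (hu j).1 (r j) (hu j).2
  refine ⟨Finset.univ.biUnion I, fun r' h => huU fun j _ => hvu j fun i hi => ?_⟩
  rw [h j i (Finset.mem_biUnion.2 ⟨j, Finset.mem_univ j, hi⟩)]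
  exact (hv j i hi).2

/-- Events that depend on finitely many sites are clopen. -/
lemma isClopen_cylinder {k : ℕ} (K : Finset Site) (S : Set (Fin k → K → Bool)) :
    IsClopen ((fun (r : Fin k → Config) (j : Fin k) (i : K) => r j i) ⁻¹' S) :=
  (isClopen_discrete S).preimage
    (continuous_pi fun j => continuous_pi fun _ => (continuous_apply _).comp (continuous_apply j))

/-! ### From weak convergence to finite dimensional distributions -/

/-- If no edge of `x` is added at one of the times `t j`, then the hitting times of the edges
determine the configurations at these times in a locally constant way. -/
lemma exists_isOpen_hit {k : ℕ} {t : Fin k → ℝ≥0} {U : Set (Fin k → Config)} (hU : IsOpen U)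
    {x : Path w} (hmono : Monotone x.toFun) (hroot : IsRooted Set.univ x)
    (hne : ∀ e j, hit x (Sum.inr e) ≠ t j) (hx : (fun j => x (t j)) ∈ U) :
    ∃ (O : Set (Edge → ℝ≥0∞)) (K : Finset Site), IsOpen O ∧ (fun e => hit x (Sum.inr e)) ∈ O ∧
      ∀ y : Path w, Monotone y.toFun → IsRooted {v | Sum.inl v ∈ K} y →
        (fun e => hit y (Sum.inr e)) ∈ O → (fun j => y (t j)) ∈ U := by
  obtain ⟨K, hK⟩ := exists_finset_cylinder hU hx
  set F := (finite_edges_source K).toFinset with hF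
  set O : Set (Edge → ℝ≥0∞) := ⋂ e ∈ F, ⋂ j, {h | (hit x (Sum.inr e) < t j → h e < t j) ∧
    ((t j : ℝ≥0∞) < hit x (Sum.inr e) → (t j : ℝ≥0∞) < h e)} with hO
  refine ⟨O, K, isOpen_biInter_finset fun e _ => isOpen_iInter_of_finite fun j => ?_, ?_, ?_⟩
  · have h1 : IsOpen {h : Edge → ℝ≥0∞ | h e < t j} :=
      isOpen_Iio.preimage (continuous_apply e)
    have h2 : IsOpen {h : Edge → ℝ≥0∞ | (t j : ℝ≥0∞) < h e} :=
      isOpen_Ioi.preimage (continuous_apply e)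
    rcases lt_or_gt_of_ne (hne e j) with h | h
    · simpa only [h, h.not_gt, true_imp_iff, false_imp_iff, and_true] using h1
    · simpa only [h, h.not_gt, true_imp_iff, false_imp_iff, true_and] using h2
  · exact Set.mem_iInter₂.2 fun e _ => Set.mem_iInter.2 fun j => ⟨id, id⟩
  · intro y hy hyroot hyO
    refine hK _ fun j => hyroot.coord_eq (hroot.subset (Set.subset_univ _)) fun e he => ?_
    obtain ⟨h1, h2⟩ := Set.mem_iInter.1 (Set.mem_iInter₂.1 hyO e (by simpa [hF] using he)) j
    rw [Bool.eq_iff_iff, ← hit_le_iff hy, ← hit_le_iff hmono]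
    rcases lt_or_gt_of_ne (hne e j) with h | h
    · exact iff_of_true (h1 h).le h.le
    · exact iff_of_false (not_le.2 (h2 h)) (not_le.2 h)

namespace IsGrowthApproximation

variable {Ω : ℕ → Type*} [∀ n, MeasurableSpace (Ω n)] {P : (n : ℕ) → Measure (Ω n)}
  [∀ n, IsProbabilityMeasure (P n)] {Ω' : Type*} [MeasurableSpace Ω'] {Q : Measure Ω'}
  [IsProbabilityMeasure Q] {X : (n : ℕ) → Ω n → Path w} {Z : Ω' → Path w}

theorem tendsto_finiteDimensional (h : IsGrowthApproximation P Q X Z)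
    (hconv : TendstoInDistribution X atTop Z P Q) (k : ℕ) (t : Fin k → ℝ≥0) :
    TendstoInDistribution (fun n ω j => X n ω (t j)) atTop (fun ω j => Z ω (t j)) P Q := by
  refine tendstoInDistribution_of_forall_isOpen
    (fun n => (measurable_pi_lambda _ fun j => h.measurable_eval n (t j)).aemeasurable)
    (measurable_pi_lambda _ fun j => h.measurable_eval_limit (t j)).aemeasurable fun U hU => ?_
  set H : Path w → Edge → ℝ≥0∞ := fun x e => hit x (Sum.inr e) with hH
  have hHc : Continuous H := continuous_pi fun e => continuous_hit _
  obtain ⟨K, hK⟩ := exists_exhaustion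
  set G : ℕ → Set (Edge → ℝ≥0∞) := fun m => ⋃₀ {O | IsOpen O ∧ ∀ y : Path w, Monotone y.toFun →
    IsRooted {v | Sum.inl v ∈ K m} y → H y ∈ O → (fun j => y (t j)) ∈ U} with hG
  have hGopen : ∀ m, IsOpen (G m) := fun m => isOpen_sUnion fun O hO => hO.1
  refine measure_le_of_eventually_mem (A := fun m => (H ∘ Z) ⁻¹' G m) ?_ fun m => ?_
  · have hne : ∀ᵐ ω ∂Q, ∀ e j, hit (Z ω) (Sum.inr e) ≠ t j := ae_all_iff.2 fun e =>
      ae_all_iff.2 fun j => ae_hit_ne h.growth_limit h.measurable_eval_limit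
        (h.continuous_limit e) (t j)
    filter_upwards [h.growth_limit, hne] with ω hω hωne hωU
    obtain ⟨O, L, hO, hxO, hOU⟩ := exists_isOpen_hit hU hω.monotone (hω.isRooted _) hωne hωU
    filter_upwards [hK L] with m hm
    exact ⟨O, ⟨hO, fun y hy hyroot hyO => hOU y hy (hyroot.subset fun v hv => hm hv) hyO⟩, hxO⟩
  · refine (le_liminf_of_isOpen (hconv.continuous_comp hHc) (hGopen m)).trans
      (liminf_le_liminf ?_)
    filter_upwards [h.rooted (K m)] with n hn
    refine measure_mono_ae ?_
    filter_upwards [hn, h.monotone n] with ω hωroot hωmono hωG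
    obtain ⟨O, ⟨-, hO⟩, hωO⟩ := hωG
    exact hO _ hωmono hωroot hωO

/-! ### From finite dimensional distributions to weak convergence -/

theorem tendsto_path (h : IsGrowthApproximation P Q X Z)
    (hconv : ∀ (k : ℕ) (t : Fin k → ℝ≥0), TendstoInDistribution (fun n ω j => X n ω (t j)) atTop
      (fun ω j => Z ω (t j)) P Q) : TendstoInDistribution X atTop Z P Q := by
  refine tendstoInDistribution_of_forall_isOpen (fun n => (h.measurable n).aemeasurable)
    h.measurable_limit.aemeasurable fun U hU => ?_
  obtain ⟨K, hK⟩ := exists_exhaustion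
  set τ : ℕ → ℝ≥0 := TopologicalSpace.denseSeq ℝ≥0 with hτ
  have hτD : Dense (Set.range τ) := TopologicalSpace.denseRange_denseSeq ℝ≥0
  -- observations at the first `m` times and on `K m` that force a path to be in `U`
  set G : (m : ℕ) → Set (Fin m → Config) := fun m => {r | ∀ y : Path w, Monotone y.toFun →
    IsRooted {v | Sum.inl v ∈ K m} y → (∀ j : Fin m, ∀ i ∈ K m, y (τ j) i = r j i) →
    y ∈ U} with hG
  have hGopen : ∀ m, IsOpen (G m) := by
    intro m
    convert! (isClopen_cylinder (K m) {s : Fin m → K m → Bool | ∀ y : Path w, Monotone y.toFun →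
      IsRooted {v | Sum.inl v ∈ K m} y → (∀ (j : Fin m) (i : K m), y (τ j) i = s j i) →
      y ∈ U}).isOpen using 1
    ext r
    simp [hG]
  refine measure_le_of_eventually_mem (A := fun m => (fun ω (j : Fin m) => Z ω (τ j)) ⁻¹' G m)
    ?_ fun m => ?_
  · filter_upwards [h.growth_limit] with ω hω hωU
    obtain ⟨ε, hε, hball⟩ := isOpen_path_iff.1 hU (Z ω) hωU
    obtain ⟨J, L, hJ, hJL⟩ := exists_skorokhodDist_lt_of_agree hω.monotone (hω.isRooted _)
      hω.hit_edge_pos (fun e f t => hω.hit_edge_injOn) hε hτD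
    have hJev : ∀ᶠ m in atTop, ∀ s ∈ J, ∃ j : Fin m, τ j = s := by
      refine (Filter.eventually_all_finset J).2 fun s hs => ?_
      obtain ⟨n, rfl⟩ := hJ hs
      filter_upwards [eventually_gt_atTop n] with m hm using ⟨⟨n, hm⟩, rfl⟩
    filter_upwards [hJev, hK L] with m hmJ hmL y hy hyroot hyx
    refine hball y (hJL y hy (hyroot.subset fun v hv => hmL hv) fun s hs i hi => ?_)
    obtain ⟨j, rfl⟩ := hmJ s hs
    exact hyx j i (hmL hi)
  · refine (le_liminf_of_isOpen (hconv m fun j => τ j) (hGopen m)).trans (liminf_le_liminf ?_)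
    filter_upwards [h.rooted (K m)] with n hn
    refine measure_mono_ae ?_
    filter_upwards [hn, h.monotone n] with ω hωroot hωmono hωG
    exact hωG _ hωmono hωroot fun j i _ => rfl

end IsGrowthApproximation

/-! ### From finite dimensional distributions to uniform convergence -/

lemma abs_measureReal_sub_le {Ω : Type*} [MeasurableSpace Ω] {μ : Measure Ω} [IsFiniteMeasure μ]
    {A B S : Set Ω} (h : ∀ᵐ ω ∂μ, ω ∉ S → (ω ∈ A ↔ ω ∈ B)) :
    |μ.real A - μ.real B| ≤ μ.real S := by
  have key : ∀ {A B : Set Ω}, (∀ᵐ ω ∂μ, ω ∉ S → (ω ∈ A ↔ ω ∈ B)) →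
      μ.real A ≤ μ.real B + μ.real S := by
    intro A B h
    refine le_trans ?_ (measureReal_union_le B S)
    refine ENNReal.toReal_mono (measure_ne_top _ _) (measure_mono_ae ?_)
    filter_upwards [h] with ω hω hA
    by_cases hS : ω ∈ S
    · exact Or.inr hS
    · exact Or.inl ((hω hS).1 hA)
  have h1 := key h
  have h2 := key (h.mono fun ω hω hS => (hω hS).symm)
  exact abs_le.2 ⟨by linarith, by linarith⟩

/-- For monotone paths, arbitrarily many observations of a finite set of sites amount to at most two
constraints per site: the site is absent at the last time at which it has to be absent, and present
at the first time at which it has to be present. -/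
lemma exists_constraints (w : Weight) (K : Finset Site) {n : ℕ} (t : Fin n → ℝ≥0)
    (L : Fin n → Config) :
    ∃ (C : Finset (K × Bool)) (s : K × Bool → ℝ≥0), (∀ c ∈ C, ∃ j, s c = t j) ∧
      ∀ y : Path w, Monotone y.toFun →
        ((∀ j, ∀ i ∈ K, y (t j) i = L j i) ↔ ∀ c ∈ C, y (s c) c.1 = c.2) := by
  classical
  have hex : ∀ c : K × Bool, ∃ s : ℝ≥0, (∃ j, L j c.1 = c.2) → (∃ j, s = t j ∧ L j c.1 = c.2) ∧
      ∀ j, L j c.1 = c.2 → (c.2 = true → s ≤ t j) ∧ (c.2 = false → t j ≤ s) := by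
    intro c
    by_cases hne : ∃ j, L j c.1 = c.2
    · obtain ⟨j₀, hj₀⟩ := hne
      have hJ : (Finset.univ.filter fun j => L j c.1 = c.2).Nonempty := ⟨j₀, by simpa using hj₀⟩
      cases hc : c.2
      · obtain ⟨j, hj, hmax⟩ := Finset.exists_max_image _ t hJ
        refine ⟨t j, fun _ => ⟨⟨j, rfl, ?_⟩, fun j' hj' => ⟨by simp, fun _ => hmax j' ?_⟩⟩⟩
        · simpa [hc] using hj
        · simpa [hc] using hj'
      · obtain ⟨j, hj, hmin⟩ := Finset.exists_min_image _ t hJ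
        refine ⟨t j, fun _ => ⟨⟨j, rfl, ?_⟩, fun j' hj' => ⟨fun _ => hmin j' ?_, by simp⟩⟩⟩
        · simpa [hc] using hj
        · simpa [hc] using hj'
    · exact ⟨0, fun h => absurd h hne⟩
  choose s hs using hex
  refine ⟨Finset.univ.filter fun c => ∃ j, L j c.1 = c.2, s, fun c hc => ?_, fun y hy => ?_⟩
  · obtain ⟨⟨j, hj, -⟩, -⟩ := hs c (by simpa using hc)
    exact ⟨j, hj⟩
  · constructor
    · intro h c hc
      obtain ⟨⟨j, hj, hL⟩, -⟩ := hs c (by simpa using hc)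
      rw [hj, h j c.1 c.1.2, hL]
    · intro h j i hi
      have h1 := h (⟨i, hi⟩, L j i) (by simp)
      obtain ⟨h2, h3⟩ := (hs (⟨i, hi⟩, L j i) ⟨j, rfl⟩).2 j rfl
      simp only at h1 h2 h3
      cases hL : L j i
      · rw [hL] at h1 h3
        have := Bool.le_iff_imp.1 (hy (h3 rfl) i)
        by_contra hne
        rw [this (by simpa using hne)] at h1
        exact absurd h1 (by simp)
      · rw [hL] at h1 h2
        exact Bool.le_iff_imp.1 (hy (h2 rfl) i) h1

lemma inter_eq_iff {K : Config} {F : Finset Site} (hF : ∀ i, i ∈ F ↔ K i = true) {η L : Config}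
    (hL : L ≤ K) : η ⊓ K = L ↔ ∀ i ∈ F, η i = L i := by
  constructor
  · rintro rfl i hi
    simp [(hF i).1 hi]
  · intro h
    ext i
    by_cases hi : i ∈ F
    · simp [h i hi, (hF i).1 hi]
    · have hK : K i = false := by simpa [hF] using hi
      have hLi : L i = false := by
        by_contra hne
        have := Bool.le_iff_imp.1 (hL i) (by simpa using hne)
        rw [hK] at this
        exact absurd this (by simp)
      simp [hK, hLi]

/-- Rounding the times of finitely many constraints on a monotone process costs at most the
probabilities that the process changes between the rounded times. -/
lemma abs_prob_constraints_sub_le {Ω : Type*} [MeasurableSpace Ω] {μ : Measure Ω}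
    [IsProbabilityMeasure μ] {Y : Ω → Path w} (hY : ∀ᵐ ω ∂μ, Monotone (Y ω).toFun)
    {F : Finset Site} {C : Finset (F × Bool)} {s lo hi : F × Bool → ℝ≥0}
    {p : Path w → Prop} (hp : ∀ y : Path w, Monotone y.toFun →
      (p y ↔ ∀ c ∈ C, y (s c) c.1 = c.2))
    (hs : ∀ c ∈ C, lo c ≤ s c ∧ s c ≤ hi c) {ε : ℝ}
    (hε : ∀ c, μ.real {ω | ∃ i ∈ F, Y ω (lo c) i ≠ Y ω (hi c) i} ≤ ε) :
    |μ.real {ω | p (Y ω)} - μ.real {ω | ∀ c ∈ C, Y ω (lo c) c.1 = c.2}| ≤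
      Fintype.card (F × Bool) * ε := by
  refine (abs_measureReal_sub_le (S := ⋃ c ∈ (Finset.univ : Finset (F × Bool)),
      {ω | ∃ i ∈ F, Y ω (lo c) i ≠ Y ω (hi c) i}) ?_).trans ?_
  · filter_upwards [hY] with ω hω hωS
    rw [hp _ hω]
    refine forall₂_congr fun c hc => ?_
    have h2 : Y ω (lo c) c.1 = Y ω (hi c) c.1 := by
      by_contra hne
      exact hωS (Set.mem_biUnion (Finset.mem_univ c) ⟨c.1, c.1.2, hne⟩)
    have h3 : Y ω (s c) c.1 = Y ω (lo c) c.1 :=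
      le_antisymm ((hω (hs c hc).2 _).trans_eq h2.symm) (hω (hs c hc).1 _)
    rw [h3]
  · refine (measureReal_biUnion_finset_le _ _).trans
      ((Finset.sum_le_sum fun c _ => hε c).trans_eq ?_)
    rw [Finset.sum_const, Finset.card_univ, nsmul_eq_mul]

namespace IsGrowthApproximation

variable {Ω : ℕ → Type*} [∀ n, MeasurableSpace (Ω n)] {P : (n : ℕ) → Measure (Ω n)}
  {Ω' : Type*} [MeasurableSpace Ω'] {Q : Measure Ω'}
  [IsProbabilityMeasure Q] {X : (n : ℕ) → Ω n → Path w} {Z : Ω' → Path w}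

/-- Changes of the limit process on a finite set of sites are unlikely, uniformly over all time
intervals of small length in a bounded time interval. -/
lemma exists_mesh (h : IsGrowthApproximation P Q X Z) (K : Finset Site) (T : ℝ≥0) {ε : ℝ}
    (hε : 0 < ε) : ∃ δ : ℝ≥0, 0 < δ ∧ ∀ s ≤ T,
      Q.real {ω | ∃ i ∈ K, Z ω s i ≠ Z ω (s + δ) i} < ε := by
  set F := (finite_edges_source K).toFinset with hF
  set G : ℝ≥0 → ℝ := fun t => ∑ e ∈ F, Q.real {ω | Z ω t (Sum.inr e) = true} with hG
  have hGc : Continuous G := continuous_finsetSum _ fun e _ => h.continuous_limit e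
  obtain ⟨δ, hδ, hGδ⟩ := Metric.uniformContinuousOn_iff.1
    ((isCompact_Icc (a := (0 : ℝ≥0)) (b := T + 1)).uniformContinuousOn_of_continuous
      hGc.continuousOn) ε hε
  refine ⟨min (δ / 2).toNNReal 1, lt_min (by simpa using hδ) one_pos, fun s hs => ?_⟩
  set t := s + min (δ / 2).toNNReal 1 with ht
  have hst : s ≤ t := le_self_add
  have hdist : dist t s < δ := by
    rw [NNReal.dist_eq, ht]
    push_cast
    rw [add_sub_cancel_left, abs_of_nonneg (by positivity)]
    refine (min_le_left _ _).trans_lt ?_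
    rw [Real.coe_toNNReal _ (by positivity)]
    linarith
  calc Q.real {ω | ∃ i ∈ K, Z ω s i ≠ Z ω t i}
      ≤ Q.real (⋃ e ∈ F, {ω | Z ω s (Sum.inr e) ≠ Z ω t (Sum.inr e)}) := by
        refine ENNReal.toReal_mono (measure_ne_top _ _) (measure_mono_ae ?_)
        filter_upwards [h.growth_limit] with ω hω hωK
        by_contra hne
        obtain ⟨i, hi, hne'⟩ := hωK
        refine hne' ((hω.isRooted _).coord_eq (hω.isRooted _) (fun e he => ?_) i hi)
        by_contra hne''
        exact hne (Set.mem_biUnion (show e ∈ F by simpa [hF] using he) hne'')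
    _ ≤ ∑ e ∈ F, Q.real {ω | Z ω s (Sum.inr e) ≠ Z ω t (Sum.inr e)} :=
        measureReal_biUnion_finset_le _ _
    _ = G t - G s := by
        rw [hG, ← Finset.sum_sub_distrib]
        exact Finset.sum_congr rfl fun e _ =>
          prob_edge_added h.growth_limit h.measurable_eval_limit e hst
    _ ≤ dist (G t) (G s) := le_abs_self _
    _ < ε := hGδ t ⟨zero_le, add_le_add hs (min_le_right _ _)⟩ s
        ⟨zero_le, hs.trans le_self_add⟩ hdist

variable [∀ n, IsProbabilityMeasure (P n)]

/-- Rounding the times to a fine grid changes the probabilities of the at most two constraints per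
site only little, and there are only finitely many events left. This gives uniformity in the number
of observations. -/
theorem uniform_of_finiteDimensional (h : IsGrowthApproximation P Q X Z)
    (hconv : ∀ (k : ℕ) (t : Fin k → ℝ≥0), TendstoInDistribution (fun n ω j => X n ω (t j)) atTop
      (fun ω j => Z ω (t j)) P Q) {ε : ℝ} (hε : 0 < ε) {K : Config}
    (hK : {x | K x = true}.Finite) (T : ℝ≥0) : ∃ N₀ : ℕ, ∀ (n : ℕ) (t : Fin n → ℝ≥0),
      (∀ i, t i ≤ T) → ∀ L : Fin n → Config, (∀ i, L i ≤ K) → ∀ N : ℕ, N₀ ≤ N →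
        |Q.real {ω | ∀ i, Z ω (t i) ⊓ K = L i} - (P N).real {ω | ∀ i, X N ω (t i) ⊓ K = L i}|
          < ε := by
  classical
  set F := hK.toFinset with hFdef
  have hF : ∀ i, i ∈ F ↔ K i = true := fun i => by simp [hFdef]
  set κ := F × Bool with hκ
  set ε' : ℝ := ε / (2 * Fintype.card κ + 2) with hε'
  have hε'0 : 0 < ε' := by positivity
  obtain ⟨δ, hδ, hmesh⟩ := h.exists_mesh F T hε'0
  set M : ℕ := ⌊T / δ⌋₊ with hM
  set g : Fin (M + 2) → ℝ≥0 := fun l => l * δ with hg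
  have hgT : ∀ l : Fin (M + 1), g l.castSucc ≤ T := by
    intro l
    have h1 : ((l : ℕ) : ℝ≥0) ≤ T / δ :=
      (Nat.cast_le.2 (Nat.lt_succ_iff.1 l.2)).trans (Nat.floor_le zero_le)
    simpa [hg] using (le_div_iff₀ hδ).1 h1
  have hgsucc : ∀ l : Fin (M + 1), g l.succ = g l.castSucc + δ := by
    intro l
    simp only [hg, Fin.val_succ, Fin.val_castSucc]
    push_cast
    ring
  -- the events that some site changes in a given cell of the grid
  have hev1 : ∀ᶠ N in atTop, ∀ l : Fin (M + 1),
      (P N).real {ω | ∃ i ∈ F, X N ω (g l.castSucc) i ≠ X N ω (g l.succ) i} < ε' := by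
    refine eventually_all.2 fun l => ?_
    have hlim := tendsto_real_of_isClopen (hconv (M + 2) g)
      (isClopen_cylinder F {r | ∃ i, r l.castSucc i ≠ r l.succ i})
    simp only [Set.preimage_ofPred_eq, Subtype.exists, exists_prop] at hlim
    refine hlim.eventually (gt_mem_nhds ?_)
    have := hmesh _ (hgT l)
    rw [← hgsucc] at this
    exact this
  -- the events that finitely many constraints hold at times of the grid
  have hev2 : ∀ᶠ N in atTop, ∀ (C : Finset κ) (a : κ → Fin (M + 1)),
      |(P N).real {ω | ∀ c ∈ C, X N ω (g (a c).castSucc) c.1 = c.2} -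
        Q.real {ω | ∀ c ∈ C, Z ω (g (a c).castSucc) c.1 = c.2}| < ε' := by
    refine eventually_all.2 fun C => eventually_all.2 fun a => ?_
    have hlim := tendsto_real_of_isClopen (hconv (M + 2) g)
      (isClopen_cylinder F {r | ∀ c ∈ C, r (a c).castSucc c.1 = c.2})
    exact (Metric.tendsto_nhds.1 hlim) ε' hε'0
  obtain ⟨N₀, hN₀⟩ := eventually_atTop.1 (hev1.and hev2)
  refine ⟨N₀, fun n t ht L hL N hN => ?_⟩
  obtain ⟨hD, hE⟩ := hN₀ N hN
  obtain ⟨C, s, hsC, hs⟩ := exists_constraints w F t L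
  set a : κ → Fin (M + 1) := fun c => ⟨min ⌊s c / δ⌋₊ M, Nat.lt_succ_iff.2 (min_le_right _ _)⟩
    with ha
  have has : ∀ c ∈ C, g (a c).castSucc ≤ s c ∧ s c ≤ g (a c).succ := by
    intro c hc
    obtain ⟨j, hj⟩ := hsC c hc
    have hac : ((a c : ℕ) : ℝ≥0) = (⌊s c / δ⌋₊ : ℕ) := by
      have : ⌊s c / δ⌋₊ ≤ M := Nat.floor_mono (by gcongr; rw [hj]; exact ht j)
      simp [ha, this]
    constructor
    · simp only [hg, Fin.val_castSucc, hac]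
      exact (le_div_iff₀ hδ).1 (Nat.floor_le zero_le)
    · simp only [hg, Fin.val_succ, Nat.cast_add, Nat.cast_one, hac]
      exact (div_le_iff₀ hδ).1 (Nat.lt_floor_add_one _).le
  have hobs : ∀ y : Path w, Monotone y.toFun →
      ((∀ i, y (t i) ⊓ K = L i) ↔ ∀ c ∈ C, y (s c) c.1 = c.2) := fun y hy => by
    rw [← hs y hy]
    exact forall_congr' fun j => inter_eq_iff hF (hL j)
  have hQ := abs_prob_constraints_sub_le (h.growth_limit.mono fun ω hω => hω.monotone) hobs has
    fun c => by rw [hgsucc]; exact (hmesh _ (hgT (a c))).le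
  have hP := abs_prob_constraints_sub_le (h.monotone N) hobs has fun c => (hD (a c)).le
  have hPQ := hE C a
  have hsum : Fintype.card κ * ε' + ε' + Fintype.card κ * ε' < ε := by
    have : ε' * (2 * Fintype.card κ + 2) = ε := div_mul_cancel₀ _ (by positivity)
    linarith
  obtain ⟨h1, h2⟩ := abs_le.1 hQ
  obtain ⟨h3, h4⟩ := abs_le.1 hP
  obtain ⟨h5, h6⟩ := abs_lt.1 hPQ
  exact abs_lt.2 ⟨by linarith, by linarith⟩

end IsGrowthApproximation

/-! ### From uniform convergence to finite dimensional distributions -/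

lemma inducedGraph_inl (A : Set Vtx) (v : Vtx) : inducedGraph A (Sum.inl v) = true ↔ v ∈ A := by
  simp [inducedGraph]

lemma inducedGraph_inr (A : Set Vtx) (e : Edge) :
    inducedGraph A (Sum.inr e) = true ↔ e.source ∈ A ∧ e.target ∈ A := by
  simp [inducedGraph]

lemma inducedGraph_mono {A B : Set Vtx} (h : A ⊆ B) : inducedGraph A ≤ inducedGraph B := by
  rintro (v | e)
  · exact Bool.le_iff_imp.2 fun hv => (inducedGraph_inl ..).2 (h ((inducedGraph_inl ..).1 hv))
  · exact Bool.le_iff_imp.2 fun he => (inducedGraph_inr ..).2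
      (((inducedGraph_inr ..).1 he).imp (@h _) (@h _))

lemma inducedGraph_isSubgraph (A : Set Vtx) : (inducedGraph A).IsSubgraph := fun e he =>
  ((inducedGraph_inr A e).1 he).imp (inducedGraph_inl A _).2 (inducedGraph_inl A _).2

lemma inducedGraph_finite {A : Set Vtx} (hA : A.Finite) :
    {i | inducedGraph A i = true}.Finite := by
  have h1 : (Sum.inl '' A : Set Site).Finite := hA.image _
  have h2 := ((finite_edges_source h1.toFinset).image (Sum.inr : Edge → Site))
  refine (h1.union h2).subset ?_
  rintro (v | e) hi
  · exact Or.inl ⟨v, (inducedGraph_inl ..).1 hi, rfl⟩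
  · refine Or.inr ⟨e, Or.inr ?_, rfl⟩
    simpa using ((inducedGraph_inr ..).1 hi).1

/-- The half box `{-m, …, m} × {0, …, m}`. -/
def halfBox (m : ℕ) : Set Vtx := Set.Icc (-(m : ℤ)) m ×ˢ Set.Icc 0 (m : ℤ)

lemma halfBox_finite (m : ℕ) : (halfBox m).Finite :=
  (Set.finite_Icc _ _).prod (Set.finite_Icc _ _)

lemma inducedGraph_halfBox_le (m : ℕ) : inducedGraph (halfBox m) ≤ halfGraph :=
  inducedGraph_mono fun _ hv => hv.2.1

lemma eventually_mem_halfBox {v : Vtx} (hv : v ∈ upperHalf) :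
    ∀ᶠ m in atTop, v ∈ halfBox m := by
  filter_upwards [eventually_ge_atTop (v.1.natAbs + v.2.natAbs)] with m hm
  have hv' : 0 ≤ v.2 := hv
  refine ⟨⟨?_, ?_⟩, hv', ?_⟩ <;> omega

lemma eventually_inducedGraph_halfBox {i : Site} (hi : halfGraph i = true) :
    ∀ᶠ m in atTop, inducedGraph (halfBox m) i = true := by
  rcases i with v | e
  · filter_upwards [eventually_mem_halfBox ((inducedGraph_inl ..).1 hi)] with m hm
    exact (inducedGraph_inl ..).2 hm
  · obtain ⟨h1, h2⟩ := (inducedGraph_inr ..).1 hi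
    filter_upwards [eventually_mem_halfBox h1, eventually_mem_halfBox h2] with m hm1 hm2
    exact (inducedGraph_inr ..).2 ⟨hm1, hm2⟩

lemma finite_le_config {K : Config} (hK : {i | K i = true}.Finite) : {η | η ≤ K}.Finite := by
  have hinj : Function.Injective fun η : Config => {i | η i = true} := by
    intro η ζ h
    ext i
    rw [Bool.eq_iff_iff]
    exact Set.ext_iff.1 h i
  refine (hK.finite_subsets.preimage hinj.injOn).subset fun η hη => ?_
  exact fun i hi => Bool.le_iff_imp.1 (hη i) hi

lemma IsGrowthPath.isSubgraph_inter {V₀ : Set Vtx} {x : Path w} (h : IsGrowthPath V₀ x) {K : Config}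
    (hK : K.IsSubgraph) (t : ℝ≥0) : (x t ⊓ K).IsSubgraph := by
  intro e he
  obtain ⟨h1, h2⟩ : x t (Sum.inr e) = true ∧ K (Sum.inr e) = true := by
    simpa [Config.edges] using he
  obtain ⟨h3, h4⟩ := hK e h2
  have h5 := h.source_mem h1
  have h6 := h.target_mem h1
  simp only [Config.verts, Set.mem_ofPred_eq] at h3 h4
  simp [Config.verts, h3, h4, h5, h6]

namespace IsGrowthApproximation

variable {Ω : ℕ → Type*} [∀ n, MeasurableSpace (Ω n)] {P : (n : ℕ) → Measure (Ω n)}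
  {Ω' : Type*} [MeasurableSpace Ω'] {Q : Measure Ω'}
  {X : (n : ℕ) → Ω n → Path w} {Z : Ω' → Path w}

/-- Convergence of the probabilities of all observations of the graph `K` at finitely many positive
times. -/
def TendstoCylinder (P : (n : ℕ) → Measure (Ω n)) (Q : Measure Ω') (X : (n : ℕ) → Ω n → Path w)
    (Z : Ω' → Path w) (K : Config) : Prop :=
  ∀ (k : ℕ), 1 ≤ k → ∀ t : Fin k → ℝ≥0, (∀ j, 0 < t j) → ∀ L : Fin k → Config,
    (∀ j, (L j).IsSubgraph ∧ L j ≤ K) →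
    Tendsto (fun n => (P n).real {ω | ∀ j, X n ω (t j) ⊓ K = L j}) atTop
      (𝓝 (Q.real {ω | ∀ j, Z ω (t j) ⊓ K = L j}))

lemma measurableSet_cylinder {Ω : Type*} [MeasurableSpace Ω] {Y : Ω → Path w}
    (hY : ∀ t, Measurable fun ω => Y ω t) {k : ℕ} (t : Fin k → ℝ≥0) (K : Config)
    (L : Fin k → Config) : MeasurableSet {ω | ∀ j, Y ω (t j) ⊓ K = L j} := by
  have hinf : Measurable fun η : Config => η ⊓ K :=
    measurable_pi_lambda _ fun i =>
      (measurable_of_finite fun b : Bool => b ⊓ K i).comp (measurable_pi_apply i)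
  rw [Set.ofPred_forall]
  exact MeasurableSet.iInter fun j => (hinf.comp (hY (t j))) (measurableSet_singleton (L j))

/-- On a finite set of sites the initial state is that of the limit. -/
lemma eventually_initial (h : IsGrowthApproximation P Q X Z) {K : Config}
    (hK : {i | K i = true}.Finite) :
    ∀ᶠ n in atTop, ∀ᵐ ω ∂P n, X n ω 0 ⊓ K = mkConfig (line 0) ∅ ⊓ K := by
  filter_upwards [h.rooted hK.toFinset] with n hn
  filter_upwards [hn, h.initial_edge n] with ω hω hωe
  refine (inter_eq_iff (F := hK.toFinset) (by simp) inf_le_right).2 fun i hi => ?_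
  have hKi : K i = true := by simpa using hi
  rw [Bool.eq_iff_iff]
  rcases i with v | e
  · rw [hω v hi]
    simp [hωe, hKi]
  · simp [hωe, mkConfig]

variable [∀ n, IsProbabilityMeasure (P n)] [IsProbabilityMeasure Q]

/-- The initial states are deterministic, so that observations at time zero can be added. -/
lemma tendsto_cylinder (h : IsGrowthApproximation P Q X Z) {K : Config}
    (hK : {i | K i = true}.Finite) (hcyl : TendstoCylinder P Q X Z K) {k : ℕ} (t : Fin k → ℝ≥0)
    {L : Fin k → Config} (hL : ∀ j, (L j).IsSubgraph ∧ L j ≤ K) :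
    Tendsto (fun n => (P n).real {ω | ∀ j, X n ω (t j) ⊓ K = L j}) atTop
      (𝓝 (Q.real {ω | ∀ j, Z ω (t j) ⊓ K = L j})) := by
  classical
  set L₀ : Config := mkConfig (line 0) ∅ ⊓ K with hL₀
  have hX0 := h.eventually_initial hK
  have hZ0 : ∀ᵐ ω ∂Q, Z ω 0 ⊓ K = L₀ := by
    filter_upwards [h.growth_limit] with ω hω
    rw [hω.initial]
  by_cases hA : ∃ j, t j = 0 ∧ L j ≠ L₀
  · obtain ⟨j, hj, hLj⟩ := hA
    have hQ : Q.real {ω | ∀ j, Z ω (t j) ⊓ K = L j} = 0 := by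
      rw [measureReal_eq_zero_iff]
      refine compl_mem_ae_iff.1 ?_
      filter_upwards [hZ0] with ω hω hωL
      exact hLj (by rw [← hωL j, hj, hω])
    rw [hQ]
    refine tendsto_const_nhds.congr' ?_
    filter_upwards [hX0] with n hn
    rw [eq_comm, measureReal_eq_zero_iff]
    refine compl_mem_ae_iff.1 ?_
    filter_upwards [hn] with ω hω hωL
    exact hLj (by rw [← hωL j, hj, hω])
  push Not at hA
  by_cases hB : ∃ j, 0 < t j
  · obtain ⟨j₀, hj₀⟩ := hB
    -- observations at time zero are replaced by repetitions of the one at `t j₀`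
    have key : ∀ y : Path w, y 0 ⊓ K = L₀ → ((∀ j, y (t j) ⊓ K = L j) ↔
        ∀ j, y (if 0 < t j then t j else t j₀) ⊓ K = if 0 < t j then L j else L j₀) := by
      intro y hy
      constructor
      · intro hyL j
        split_ifs
        · exact hyL j
        · exact hyL j₀
      · intro hyL j
        by_cases hj : 0 < t j
        · simpa [hj] using hyL j
        · have hj' : t j = 0 := by simpa using hj
          rw [hj', hy, hA j hj']
    have hlim := hcyl k j₀.pos (fun j => if 0 < t j then t j else t j₀)
      (fun j => by split_ifs with hj; exacts [hj, hj₀])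
      (fun j => if 0 < t j then L j else L j₀)
      (fun j => by split_ifs; exacts [hL j, hL j₀])
    have hQ : Q.real {ω | ∀ j, Z ω (t j) ⊓ K = L j} = Q.real {ω | ∀ j,
        Z ω (if 0 < t j then t j else t j₀) ⊓ K = if 0 < t j then L j else L j₀} := by
      refine measureReal_congr ?_
      filter_upwards [hZ0] with ω hω using propext (key _ hω)
    rw [hQ]
    refine hlim.congr' ?_
    filter_upwards [hX0] with n hn
    refine measureReal_congr ?_
    filter_upwards [hn] with ω hω using propext (key _ hω).symm
  · have ht : ∀ j, t j = 0 := fun j => by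
      by_contra hne
      exact hB ⟨j, pos_iff_ne_zero.2 hne⟩
    have hQ : Q.real {ω | ∀ j, Z ω (t j) ⊓ K = L j} = 1 := by
      rw [← probReal_univ (μ := Q)]
      refine measureReal_congr ?_
      filter_upwards [hZ0] with ω hω
      exact propext ⟨fun _ => trivial, fun _ j => by rw [ht, hω, hA j (ht j)]⟩
    rw [hQ]
    refine tendsto_const_nhds.congr' ?_
    filter_upwards [hX0] with n hn
    rw [← probReal_univ (μ := P n)]
    refine measureReal_congr ?_
    filter_upwards [hn] with ω hω
    exact propext ⟨fun _ j => by rw [ht, hω, hA j (ht j)], fun _ => trivial⟩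

theorem finiteDimensional_of_tendstoCylinder (h : IsGrowthApproximation P Q X Z)
    (hcyl : ∀ m, TendstoCylinder P Q X Z (inducedGraph (halfBox m))) (k : ℕ) (t : Fin k → ℝ≥0) :
    TendstoInDistribution (fun n ω j => X n ω (t j)) atTop (fun ω j => Z ω (t j)) P Q := by
  classical
  refine tendstoInDistribution_of_forall_isOpen
    (fun n => (measurable_pi_lambda _ fun j => h.measurable_eval n (t j)).aemeasurable)
    (measurable_pi_lambda _ fun j => h.measurable_eval_limit (t j)).aemeasurable fun U hU => ?_
  set B : ℕ → Config := fun m => inducedGraph (halfBox m) with hB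
  have hBfin : ∀ m, {i | B m i = true}.Finite := fun m => inducedGraph_finite (halfBox_finite m)
  -- observations in the half box that force the configurations to be in `U`
  set G : ℕ → Set (Fin k → Config) := fun m => {L | (∀ j, (L j).IsSubgraph ∧ L j ≤ B m) ∧
    ∀ r : Fin k → Config, (∀ j, r j ≤ halfGraph) → (∀ j, r j ⊓ B m = L j) → r ∈ U} with hG
  have hGfin : ∀ m, (G m).Finite := fun m =>
    (Set.Finite.pi fun _ => finite_le_config (hBfin m)).subset fun L hL j _ => (hL.1 j).2
  refine measure_le_of_eventually_mem
    (A := fun m => ⋃ L ∈ (hGfin m).toFinset, {ω | ∀ j, Z ω (t j) ⊓ B m = L j}) ?_ fun m => ?_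
  · filter_upwards [h.growth_limit, h.le_halfGraph_limit] with ω hω hωH hωU
    obtain ⟨K, hK⟩ := exists_finset_cylinder hU hωU
    have hev : ∀ᶠ m in atTop, ∀ i ∈ K, halfGraph i = true → B m i = true := by
      refine (Filter.eventually_all_finset K).2 fun i _ => ?_
      by_cases hi : halfGraph i = true
      · filter_upwards [eventually_inducedGraph_halfBox hi] with m hm _ using hm
      · exact Eventually.of_forall fun m h => absurd h hi
    filter_upwards [hev] with m hm
    refine Set.mem_biUnion (x := fun j => Z ω (t j) ⊓ B m) ?_ fun j => rfl
    refine (hGfin m).mem_toFinset.2 ⟨fun j => ⟨hω.isSubgraph_inter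
      (inducedGraph_isSubgraph _) _, inf_le_right⟩, fun r hr hrB => hK r fun j i hi => ?_⟩
    by_cases hiH : halfGraph i = true
    · simpa [hm i hi hiH] using congr_fun (hrB j) i
    · have hfalse : ∀ η : Config, η ≤ halfGraph → η i = false := fun η hη => by
        by_contra hne
        exact hiH (Bool.le_iff_imp.1 (hη i) (by simpa using hne))
      exact (hfalse _ (hr j)).trans (hfalse _ (hωH _)).symm
  · have hlim : Tendsto (fun n => ∑ L ∈ (hGfin m).toFinset,
        P n {ω | ∀ j, X n ω (t j) ⊓ B m = L j}) atTop
        (𝓝 (∑ L ∈ (hGfin m).toFinset, Q {ω | ∀ j, Z ω (t j) ⊓ B m = L j})) := by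
      refine tendsto_finsetSum _ fun L hL => ?_
      exact (ENNReal.tendsto_toReal_iff (fun _ => measure_ne_top _ _) (measure_ne_top _ _)).1
        (h.tendsto_cylinder (hBfin m) (hcyl m) t ((hGfin m).mem_toFinset.1 hL).1)
    refine (measure_biUnion_finset_le _ _).trans (hlim.liminf_eq.symm.le.trans
      (liminf_le_liminf (Eventually.of_forall fun n => ?_)))
    rw [← measure_biUnion_finset]
    · refine measure_mono fun ω hω => ?_
      obtain ⟨L, hL, hωL⟩ := Set.mem_iUnion₂.1 hω
      exact ((hGfin m).mem_toFinset.1 hL).2 _ (fun j => h.le_halfGraph n ω _) hωL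
    · intro L _ L' _ hne
      refine Set.disjoint_left.2 fun ω hω hω' => hne (funext fun j => ?_)
      rw [← hω j, ← hω' j]
    · exact fun L _ => measurableSet_cylinder (h.measurable_eval n) t _ L

end IsGrowthApproximation

end DLA

theorem mainTheorem6 (w : DLA.Weight)
    {Ω : ℕ → Type*} [∀ n, MeasurableSpace (Ω n)]
    (P : (n : ℕ) → Measure (Ω n)) [∀ n, IsProbabilityMeasure (P n)]
    {Ω' : Type*} [MeasurableSpace Ω'] (Q : Measure Ω') [IsProbabilityMeasure Q]
    (EA : (n : ℕ) → Ω n → DLA.Path w) (hEA : ∀ n, DLA.IsEDLA (P n) (DLA.segment n) (EA n))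
    (SA : Ω' → DLA.Path w) (hSA : DLA.IsInfiniteSDLA Q SA)
    (c : ℝ≥0) (hc : 0 < c) :
    -- weak convergence in the Skorokhod topology iff convergence of all finite dimensional
    -- distributions
    (TendstoInDistribution (fun n ω => ((EA n ω).speed n).inter DLA.halfGraph) atTop
        (fun ω => (SA ω).speed c) P Q ↔
      ∀ (k : ℕ) (t : Fin k → ℝ≥0),
        TendstoInDistribution (fun n ω i => ((EA n ω).speed n).inter DLA.halfGraph (t i)) atTop
          (fun ω i => (SA ω).speed c (t i)) P Q) ∧
    -- convergence of all finite dimensional distributions iff locally uniform convergence of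
    -- the probabilities of cylinder events
    ((∀ (k : ℕ) (t : Fin k → ℝ≥0),
        TendstoInDistribution (fun n ω i => ((EA n ω).speed n).inter DLA.halfGraph (t i)) atTop
          (fun ω i => (SA ω).speed c (t i)) P Q) ↔
      ∀ ε : ℝ, 0 < ε → ∀ K : DLA.Config, K.IsSubgraph → {x | K x = true}.Finite →
        K ≤ DLA.halfGraph → ∀ T : ℝ≥0, ∃ N₀ : ℕ,
          ∀ n : ℕ, 1 ≤ n → ∀ t : Fin n → ℝ≥0, (∀ i, 0 < t i ∧ t i ≤ T) →
          ∀ L : Fin n → DLA.Config, (∀ i, (L i).IsSubgraph ∧ L i ≤ K) →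
          ∀ N : ℕ, N₀ ≤ N →
            |Q.real {ω | ∀ i, SA ω (c * t i) ⊓ K = L i} -
              (P N).real {ω | ∀ i, EA N ω (N * t i) ⊓ K = L i}| < ε) := by
  have h := DLA.isGrowthApproximation hEA hSA hc
  have hinter : ∀ {K : DLA.Config}, K ≤ DLA.halfGraph → ∀ N (ω : Ω N) (s : ℝ≥0),
      ((EA N ω).speed N).inter DLA.halfGraph s ⊓ K = EA N ω (N * s) ⊓ K := by
    intro K hK N ω s
    change EA N ω (N * s) ⊓ DLA.halfGraph ⊓ K = EA N ω (N * s) ⊓ K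
    rw [inf_assoc, inf_eq_right.2 hK]
  refine ⟨⟨h.tendsto_finiteDimensional, h.tendsto_path⟩, fun hconv => ?_, fun hunif => ?_⟩
  · intro ε hε K _ hKfin hKH T
    obtain ⟨N₀, hN₀⟩ := h.uniform_of_finiteDimensional hconv hε hKfin T
    refine ⟨N₀, fun n _ t ht L hL N hN => ?_⟩
    have := hN₀ n t (fun i => (ht i).2) L (fun i => (hL i).2) N hN
    simp only [hinter hKH] at this
    exact this
  · refine h.finiteDimensional_of_tendstoCylinder fun m k hk t ht L hL => ?_
    have hH := DLA.inducedGraph_halfBox_le m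
    refine Metric.tendsto_atTop.2 fun ε hε => ?_
    obtain ⟨N₀, hN₀⟩ := hunif ε hε _ (DLA.inducedGraph_isSubgraph _)
      (DLA.inducedGraph_finite (DLA.halfBox_finite m)) hH (∑ i, t i)
    refine ⟨N₀, fun N hN => ?_⟩
    have := hN₀ k hk t (fun i => ⟨ht i, Finset.single_le_sum (fun _ _ => zero_le)
      (Finset.mem_univ i)⟩) L hL N hN
    simp only [hinter hH]
    rw [dist_comm]
    exact this
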